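/- Conventions. Turing degrees are degrees of total functions $\omega\to\omega$ (equivalently, of subsets of $\omega$), and $\mathcal D(\ge\mathbf a)=\{\mathbf e:\mathbf a\le\mathbf e\}$ is the cone above $\mathbf a$. Languages are computable; a computable structure is a structure for such a language whose universe is a computable subset of $\omega$ and whose atomic diagram is computable; a computable copy of $\mathcal M$ is a computable structure in the same language isomorphic to $\mathcal M$. For computable structures $\mathcal A,\mathcal B$ in the same language, $$\mathrm{IsoSpec}(\mathcal A,\mathcal B)=\{\mathbf e:\text{there is an isomorphism } f:\mathcal A\cong\mathcal B \text{ with } f\le_T\mathbf e\},$$ and $\mathrm{CatSpec}(\mathcal M)$ is the intersection of the sets $\mathrm{IsoSpec}(\mathcal M,\mathcal B)$ over all computable copies $\mathcal B$ of $\mathcal M$. The degree $\mathbf d$ is the degree of categoricity of $\mathcal M$ if $\mathrm{CatSpec}(\mathcal M)=\mathcal D(\ge\mathbf d)$. The spectral dimension of $\mathcal M$ is the least cardinality $k$, $1\le k\le\omega$, of a nonempty set $X$ of pairs of computable copies of $\mathcal M$ with $\mathrm{CatSpec}(\mathcal M)=\bigcap_{(\mathcal A,\mathcal B)\in X}\mathrm{IsoSpec}(\mathcal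 A,\mathcal B)$. The degree $\mathbf d$ is the strong degree of categoricity of $\mathcal M$ if $\mathbf d$ is the degree of categoricity of $\mathcal M$ and $\mathcal M$ has spectral dimension $1$. Theorem A. Suppose that $\mathbf d$ is the degree of categoricity of a computable structure $\mathcal M$, and that $\mathbf d$ is not the strong degree of categoricity of any computable structure (in any computable language). Then $\mathcal M$ has infinite spectral dimension, $\mathcal M$ has an infinite automorphism group, and there are computable copies $\mathcal A$ and $\mathcal B$ of $\mathcal M$ such that $\mathrm{IsoSpec}(\mathcal A,\mathcal B)$ is not finitely generated, that is, is not equal to a union of finitely many cones $\mathcal D(\ge\mathbf a)$. -/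

import Mathlib

open FirstOrder

namespace CompStr

/-! ### Turing degrees -/

/-- Total functions `ℕ → ℕ`, used as oracles and ordered by Turing reducibility (a type of its own,
so that the pointwise order on `ℕ → ℕ` plays no role). -/
structure Oracle where
  /-- The underlying total function. -/
  toFun : ℕ → ℕ

/-- `f ≤ g` iff `f` is Turing reducible to `g`. -/
instance : Preorder Oracle where
  le f g := TuringReducible (f.toFun : ℕ →. ℕ) (g.toFun : ℕ →. ℕ)
  le_refl f := TuringReducible.refl _
  le_trans _ _ _ hfg hgh := TuringReducible.trans hfg hgh

/-- The Turing degrees: total functions modulo mutual Turing reducibility, partially ordered by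
Turing reducibility. (Mathlib's `TuringDegree` consists of the classes of all *partial* functions,
which is a larger structure than the classical one.) -/
abbrev Degree : Type := Antisymmetrization Oracle (· ≤ ·)

/-- The Turing degree of a total function. -/
def deg (f : ℕ → ℕ) : Degree := toAntisymmetrization (· ≤ ·) (Oracle.mk f)

/-! ### Computable languages and computable structures -/

/-- A computable first-order language: the function symbols and the relation symbols are coded by
natural numbers, `funArity i = some n` says that `i` is a function symbol of arity `n`, and
`funArity i = none` says that `i` is not a function symbol; likewise for relation symbols. -/
structure CompLanguage where
  /-- Arity of the `i`-th function symbol, if there is one. -/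
  funArity : ℕ → Option ℕ
  /-- Arity of the `i`-th relation symbol, if there is one. -/
  relArity : ℕ → Option ℕ
  funArity_computable : Computable funArity
  relArity_computable : Computable relArity

/-- The underlying first-order language. -/
def CompLanguage.toLanguage (L : CompLanguage) : FirstOrder.Language.{0, 0} where
  Functions n := {i : ℕ // L.funArity i = some n}
  Relations n := {i : ℕ // L.relArity i = some n}

/-- A computable structure: its universe is a computable set of natural numbers, and the
interpretations of all symbols are computable, uniformly in the symbol
(that is, its atomic diagram is computable). -/
structure CompStructure (L : CompLanguage) where
  /-- The universe. -/
  dom : Set ℕ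
  /-- The interpretation of the symbols. -/
  str : L.toLanguage.Structure dom
  dom_computable : ComputablePred fun x : ℕ => x ∈ dom
  /-- "`i` is a function symbol, and its interpretation maps the tuple `v` to `y`". -/
  funs_computable : ComputablePred fun p : ℕ × List ℕ × ℕ =>
    ∃ (n : ℕ) (h : L.funArity p.1 = some n) (v : Fin n → dom),
      p.2.1 = List.ofFn (fun j => (v j : ℕ)) ∧ (str.funMap ⟨p.1, h⟩ v : ℕ) = p.2.2
  /-- "`i` is a relation symbol, and its interpretation holds of the tuple `v`". -/
  rels_computable : ComputablePred fun p : ℕ × List ℕ =>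
    ∃ (n : ℕ) (h : L.relArity p.1 = some n) (v : Fin n → dom),
      p.2 = List.ofFn (fun j => (v j : ℕ)) ∧ str.RelMap ⟨p.1, h⟩ v

variable {L : CompLanguage}

/-- The universe of a computable structure, as a type. -/
def CompStructure.Carrier (A : CompStructure L) : Type := A.dom

instance (A : CompStructure L) : L.toLanguage.Structure A.Carrier := A.str

/-- Isomorphisms between computable structures of the same language. -/
abbrev Iso (A B : CompStructure L) : Type := A.Carrier ≃[L.toLanguage] B.Carrier

open scoped Classical in
/-- An isomorphism as a total function on `ℕ`, with value `0` off the universe of `A`. As that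
universe is computable, this function has the Turing degree of (the graph of) the isomorphism. -/
noncomputable def Iso.total {A B : CompStructure L} (f : Iso A B) : ℕ → ℕ := fun x =>
  if h : x ∈ A.dom then (f.toEquiv (⟨x, h⟩ : A.dom) : B.dom).val else 0

/-- `B` is a computable copy of `A`. -/
def IsCopy (A B : CompStructure L) : Prop := Nonempty (Iso A B)

/-! ### Spectra -/

/-- The isomorphism spectrum: the degrees that compute some isomorphism from `A` to `B`. -/
def IsoSpec (A B : CompStructure L) : Set Degree := {d | ∃ f : Iso A B, deg f.total ≤ d}

/-- `A` is `d`-computably categorical. -/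
def IsCompCategorical (d : Degree) (A : CompStructure L) : Prop :=
  ∀ B : CompStructure L, IsCopy A B → d ∈ IsoSpec A B

/-- The categoricity spectrum. -/
def CatSpec (A : CompStructure L) : Set Degree := {d | IsCompCategorical d A}

/-- `d` is the degree of categoricity of `A`: the categoricity spectrum is the cone above `d`. -/
def IsDegreeOfCategoricity (d : Degree) (A : CompStructure L) : Prop := CatSpec A = Set.Ici d

/-- The spectral dimension of `M`: the least cardinality (a positive integer or infinity) of a
nonempty set `X` of pairs of computable copies of `M` such that the categoricity spectrum of `M` is
the intersection of the isomorphism spectra of the pairs in `X`.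

The set of all pairs of computable copies of `M` is such an `X`, and it is countable, so
the value `⊤` means that the spectral dimension is `ω`. -/
noncomputable def SpecDim (M : CompStructure L) : ℕ∞ :=
  sInf {k : ℕ∞ | ∃ X : Set (CompStructure L × CompStructure L),
    X.Nonempty ∧ (∀ p ∈ X, IsCopy M p.1 ∧ IsCopy M p.2) ∧ X.encard = k ∧
      CatSpec M = ⋂ p ∈ X, IsoSpec p.1 p.2}

/-- `d` is the strong degree of categoricity of `A`. -/
def IsStrongDegreeOfCategoricity (d : Degree) (A : CompStructure L) : Prop :=
  IsDegreeOfCategoricity d A ∧ SpecDim A = 1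

/-- A set of degrees is finitely generated if it is a union of finitely many cones. -/
def FinitelyGenerated (Z : Set Degree) : Prop :=
  ∃ X : Set Degree, X.Finite ∧ X ⊆ Z ∧ Z = ⋃ d ∈ X, Set.Ici d

end CompStr

/-! Two constructions carry the proof.

Finite dimension gives a strong degree. Suppose that finitely many pairs `(A i, B i)`, `i < k`,
witness the spectral dimension of `M`. Let `N` be the disjoint union of `k` copies of `M`, with
separate relation symbols for each component, so that isomorphisms respect the numbering of the
components. A copy of `N` is then just a `k`-tuple of copies of `M`, and an isomorphism is a
`k`-tuple of isomorphisms; hence `IsoSpec` of two unions is the intersection of the componentwise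
spectra (`Decomp.isoSpec_eq`), and `N` has the same categoricity spectrum as `M` (`catSpec_union`).
The single pair (union of the `A i`, union of the `B i`) now realizes that spectrum, so `d` is the
strong degree of categoricity of `N` (`exists_strong_of_finite`). As this is excluded by hypothesis,
the spectral dimension is infinite.

Finitely generated spectra give finite dimension. There are only countably many copies `B` of `M`,
and the spectra `IsoSpec M B` intersect in the cone above `d`. If all of them were finitely
generated but no finite subfamily had its intersection inside that cone, an ultrafilter would select
one generator from each so that no finite join of the selected generators computes `d`. A
finite-extension construction (`exists_upper_bound_not_red`) gives an upper bound of all the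
selected generators that does not compute `d`, although it lies in every spectrum: a contradiction.
So a finite subfamily suffices and the dimension is finite. Hence some `IsoSpec M B` is not finitely
generated.

If `M` had finitely many automorphisms, there would be finitely many isomorphisms from `M` to `B`,
and their degrees would generate `IsoSpec M B`. So the automorphism group is infinite. -/

namespace CompStr

/-! ### Turing reducibility between total functions -/

/-- Turing reducibility of total functions. -/
def Red (f g : ℕ → ℕ) : Prop := Nat.RecursiveIn {(g : ℕ →. ℕ)} (f : ℕ →. ℕ)

theorem deg_le_deg {f g : ℕ → ℕ} : deg f ≤ deg g ↔ Red f g :=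
  toAntisymmetrization_le_toAntisymmetrization_iff.trans RecursiveIn.iff_nat

theorem exists_deg_eq (e : Degree) : ∃ g, deg g = e := by
  induction e using Antisymmetrization.ind with
  | _ g => exact ⟨g.toFun, rfl⟩

namespace Red

theorem refl (f : ℕ → ℕ) : Red f f := .oracle _ rfl

theorem trans {f g h : ℕ → ℕ} (hf : Red f g) (hg : Red g h) : Red f h :=
  hf.subst (by rintro _ rfl; exact hg)

theorem of_computable {f : ℕ → ℕ} (hf : Computable f) (g : ℕ → ℕ) : Red f g :=
  Nat.Partrec.recursiveIn (Partrec.nat_iff.1 hf)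

theorem comp {f h g : ℕ → ℕ} (hf : Red f g) (hh : Red h g) : Red (fun x => f (h x)) g :=
  (Nat.RecursiveIn.comp hf hh).of_eq fun n => Part.bind_some (h n) (f : ℕ →. ℕ)

theorem pair {f h g : ℕ → ℕ} (hf : Red f g) (hh : Red h g) :
    Red (fun x => Nat.pair (f x) (h x)) g :=
  (Nat.RecursiveIn.pair hf hh).of_eq fun n => by
    simp [Seq.seq]

theorem comp₂ {G : ℕ → ℕ → ℕ} (hG : Computable₂ G) {f h g : ℕ → ℕ} (hf : Red f g)
    (hh : Red h g) : Red (fun x => G (f x) (h x)) g := by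
  have hG' : Computable fun p : ℕ => G p.unpair.1 p.unpair.2 :=
    hG.comp (Computable.fst.comp Computable.unpair) (Computable.snd.comp Computable.unpair)
  simpa using (of_computable hG' g).comp (hf.pair hh)

theorem comp₃ {G : ℕ → ℕ → ℕ → ℕ} (hG : Computable fun p : ℕ × ℕ × ℕ => G p.1 p.2.1 p.2.2)
    {f h i g : ℕ → ℕ} (hf : Red f g) (hh : Red h g) (hi : Red i g) :
    Red (fun x => G (f x) (h x) (i x)) g := by
  have hG' : Computable₂ fun p q : ℕ => G p q.unpair.1 q.unpair.2 := by
    refine hG.comp (Computable.pair Computable.fst (Computable.pair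
      (Computable.fst.comp (Computable.unpair.comp Computable.snd))
      (Computable.snd.comp (Computable.unpair.comp Computable.snd))))
  simpa using comp₂ hG' hf (hh.pair hi)

end Red

/-! ### Initial segments of oracles and the use principle -/

/-- The list of the first `n` values of `g`. -/
def initSeg (g : ℕ → ℕ) (n : ℕ) : List ℕ := (List.range n).map g

@[simp] theorem length_initSeg (g : ℕ → ℕ) (n : ℕ) : (initSeg g n).length = n := by
  simp [initSeg]

theorem initSeg_getElem? (g : ℕ → ℕ) (n j : ℕ) :
    (initSeg g n)[j]? = if j < n then some (g j) else none := by
  unfold initSeg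
  split_ifs with h <;> simp [h]

theorem initSeg_prefix (g : ℕ → ℕ) {m n : ℕ} (h : m ≤ n) : initSeg g m <+: initSeg g n := by
  obtain ⟨k, rfl⟩ := Nat.exists_eq_add_of_le h
  simp [initSeg, List.range_add]

theorem Red.initSeg (g : ℕ → ℕ) : Red (fun n => Encodable.encode (initSeg g n)) g := by
  have hS : Computable₂ fun p v : ℕ => Encodable.encode
      (((Encodable.decode (α := List ℕ) p.unpair.2.unpair.2).getD []) ++ [v]) := by
    refine Computable.encode.comp (Computable.list_concat.comp
      (Computable.option_getD (Computable.decode.comp ?_) (Computable.const _)) Computable.snd)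
    exact Computable.snd.comp (Computable.unpair.comp
      (Computable.snd.comp (Computable.unpair.comp Computable.fst)))
  have hy : Computable fun p : ℕ => p.unpair.2.unpair.1 :=
    Computable.fst.comp (Computable.unpair.comp (Computable.snd.comp Computable.unpair))
  have hstep := Red.comp₂ hS (Red.of_computable Computable.id g)
    ((Red.refl g).comp (Red.of_computable hy g))
  have hrec := Nat.RecursiveIn.prec
    (Red.of_computable (Computable.const (Encodable.encode ([] : List ℕ))) g) hstep
  have h0 : Computable fun n : ℕ => Nat.pair 0 n :=
    (Primrec₂.natPair.comp (Primrec.const 0) Primrec.id).to_comp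
  refine (Nat.RecursiveIn.comp hrec (Red.of_computable h0 g)).of_eq fun n => ?_
  simp only [PFun.coe_val, Part.bind_eq_bind, Part.bind_some, Nat.unpair_pair]
  induction n with
  | zero => simp [CompStr.initSeg]
  | succ n ih =>
    simp only [ih, Part.bind_some]
    simp [CompStr.initSeg, List.range_succ]

/-- Functions that can be searched for in initial segments of the oracle are reducible to it. -/
theorem red_of_approx {F : List ℕ → ℕ → Option ℕ} (hF : Computable₂ F) {h g : ℕ → ℕ}
    (hex : ∀ x, ∃ n y, F (initSeg g n) x = some y)
    (huniq : ∀ x n y, F (initSeg g n) x = some y → y = h x) : Red h g := by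
  have hval : Computable₂ fun x s : ℕ => Encodable.encode
      (F ((Encodable.decode (α := List ℕ) s).getD []) x) := by
    refine Computable.encode.comp (hF.comp
      (Computable.option_getD (Computable.decode.comp Computable.snd) (Computable.const _))
      Computable.fst)
  have hu1 : Computable fun p : ℕ => p.unpair.1 := Computable.fst.comp Computable.unpair
  have hu2 : Computable fun p : ℕ => p.unpair.2 := Computable.snd.comp Computable.unpair
  have hv := Red.comp₂ hval (Red.of_computable hu1 g)
    ((Red.initSeg g).comp (Red.of_computable hu2 g))
  -- `none` is coded by `0` and `some y` by `y + 1`. So `1 - n` turns success into the zero that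
  -- `Nat.rfind` looks for, and the predecessor recovers `y` at the end.
  have hsub : Computable fun n : ℕ => 1 - n :=
    (Primrec.nat_sub.comp (Primrec.const 1) Primrec.id).to_comp
  have hpred : Computable fun n : ℕ => n - 1 := Computable.pred
  let q : ℕ → ℕ →. Bool := fun x n => Part.some (F (initSeg g n) x).isSome
  have hsearch : Nat.RecursiveIn {(g : ℕ →. ℕ)} fun x => Nat.rfind (q x) := by
    refine (Nat.RecursiveIn.rfind ((Red.of_computable hsub g).comp hv)).of_eq fun x => ?_
    refine congrArg Nat.rfind (funext fun n => ?_)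
    simp only [q, PFun.coe_val, Part.map_eq_map, Part.map_some, Nat.unpair_pair,
      Encodable.encodek, Option.getD_some]
    cases F (initSeg g n) x <;> simp
  have hfin := Nat.RecursiveIn.comp ((Red.of_computable hpred g).comp hv)
    (Nat.RecursiveIn.pair (Red.of_computable Computable.id g) hsearch)
  refine hfin.of_eq_tot fun x => ?_
  obtain ⟨n, hn⟩ : ∃ n, n ∈ Nat.rfind (q x) := by
    obtain ⟨n, y, hy⟩ := hex x
    exact Part.dom_iff_mem.1 (Nat.rfind_dom.2 ⟨n, by simp [q, hy], fun {m} _ => trivial⟩)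
  have hs : (F (initSeg g n) x).isSome := by simpa [q] using Nat.rfind_spec hn
  obtain ⟨y, hy⟩ := Option.isSome_iff_exists.1 hs
  obtain rfl := huniq x n y hy
  refine Part.mem_bind_iff.2 ⟨Nat.pair x n, ?_, by simp [hy]⟩
  simpa [Seq.seq] using hn

/-- Functions recursive in `g` are the limits of monotone primitive recursive approximations along
initial segments of `g`. -/
theorem exists_approx {g : ℕ → ℕ} {p : ℕ →. ℕ} (hp : Nat.RecursiveIn {(g : ℕ →. ℕ)} p) :
    ∃ F : List ℕ → ℕ → Option ℕ, Primrec₂ F ∧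
      (∀ σ τ x y, σ <+: τ → F σ x = some y → F τ x = some y) ∧
      ∀ x y, y ∈ p x ↔ ∃ n, F (initSeg g n) x = some y := by
  induction hp with
  | zero =>
    exact ⟨fun _ _ => some 0, Primrec.const _, by simp,
      fun x y => (Part.mem_some_iff (b := y) (a := 0)).trans (by simp [eq_comm])⟩
  | succ =>
    exact ⟨fun _ x => some (x + 1), Primrec.option_some.comp (Primrec.succ.comp Primrec.snd),
      by simp, by simp [eq_comm]⟩
  | left =>
    exact ⟨fun _ x => some x.unpair.1,
      Primrec.option_some.comp (Primrec.fst.comp (Primrec.unpair.comp Primrec.snd)),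
      by simp, by simp [eq_comm]⟩
  | right =>
    exact ⟨fun _ x => some x.unpair.2,
      Primrec.option_some.comp (Primrec.snd.comp (Primrec.unpair.comp Primrec.snd)),
      by simp, by simp [eq_comm]⟩
  | oracle h hh =>
    obtain rfl := hh
    refine ⟨fun σ x => σ[x]?, Primrec.list_getElem?, ?_, fun x y => ?_⟩
    · rintro σ _ x y ⟨ρ, rfl⟩ h
      exact (List.getElem?_append_left (List.getElem?_eq_some_iff.1 h).1).trans h
    · simp only [PFun.coe_val, Part.mem_some_iff, initSeg_getElem?]
      refine ⟨fun h => ⟨x + 1, by simp [h]⟩, ?_⟩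
      rintro ⟨n, h⟩
      split_ifs at h
      simpa using h.symm
  | @pair f h _ _ ihf ihh =>
    obtain ⟨F, hF, mF, eF⟩ := ihf
    obtain ⟨H, hH, mH, eH⟩ := ihh
    refine ⟨fun σ x => (F σ x).bind fun a => (H σ x).map fun b => Nat.pair a b, ?_, ?_, ?_⟩
    · refine Primrec.option_bind hF (Primrec.option_map (hH.comp
        (Primrec.fst.comp Primrec.fst) (Primrec.snd.comp Primrec.fst)) ?_)
      exact Primrec₂.natPair.comp (Primrec.snd.comp Primrec.fst) Primrec.snd
    · intro σ τ x y hστ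
      simp only [Option.bind_eq_some_iff, Option.map_eq_some_iff]
      rintro ⟨a, ha, b, hb, rfl⟩
      exact ⟨a, mF _ _ _ _ hστ ha, b, mH _ _ _ _ hστ hb, rfl⟩
    · intro x y
      simp only [Option.bind_eq_some_iff, Option.map_eq_some_iff, Seq.seq, Part.map_eq_map,
        Part.mem_bind_iff, Part.mem_map_iff, exists_exists_and_eq_and, eF, eH]
      constructor
      · rintro ⟨a, ⟨n, ha⟩, b, ⟨m, hb⟩, rfl⟩
        exact ⟨max n m, a, mF _ _ _ _ (initSeg_prefix g (le_max_left _ _)) ha, b,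
          mH _ _ _ _ (initSeg_prefix g (le_max_right _ _)) hb, rfl⟩
      · rintro ⟨n, a, ha, b, hb, rfl⟩
        exact ⟨a, ⟨n, ha⟩, b, ⟨n, hb⟩, rfl⟩
  | @comp f h _ _ ihf ihh =>
    obtain ⟨F, hF, mF, eF⟩ := ihf
    obtain ⟨H, hH, mH, eH⟩ := ihh
    refine ⟨fun σ x => (H σ x).bind fun a => F σ a, ?_, ?_, ?_⟩
    · exact Primrec.option_bind hH (hF.comp (Primrec.fst.comp Primrec.fst) Primrec.snd)
    · intro σ τ x y hστ
      simp only [Option.bind_eq_some_iff]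
      rintro ⟨a, ha, hb⟩
      exact ⟨a, mH _ _ _ _ hστ ha, mF _ _ _ _ hστ hb⟩
    · intro x y
      refine Part.mem_bind_iff.trans ?_
      simp only [Option.bind_eq_some_iff, eF, eH]
      constructor
      · rintro ⟨a, ⟨n, ha⟩, ⟨m, hb⟩⟩
        exact ⟨max n m, a, mH _ _ _ _ (initSeg_prefix g (le_max_left _ _)) ha,
          mF _ _ _ _ (initSeg_prefix g (le_max_right _ _)) hb⟩
      · rintro ⟨n, a, ha, hb⟩
        exact ⟨a, ⟨n, ha⟩, n, hb⟩
  | @prec f h _ _ ihf ihh =>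
    obtain ⟨F, hF, mF, eF⟩ := ihf
    obtain ⟨H, hH, mH, eH⟩ := ihh
    let R : List ℕ → ℕ → ℕ → Option ℕ := fun σ a n =>
      n.rec (F σ a) fun y IH => IH.bind fun i => H σ (Nat.pair a (Nat.pair y i))
    have mR : ∀ σ τ a n y, σ <+: τ → R σ a n = some y → R τ a n = some y := by
      intro σ τ a n y hστ
      induction n generalizing y with
      | zero => exact mF _ _ _ _ hστ
      | succ n ih =>
        simp only [R, Option.bind_eq_some_iff] at ih ⊢
        rintro ⟨i, hi, hy⟩
        exact ⟨i, ih _ hi, mH _ _ _ _ hστ hy⟩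
    refine ⟨fun σ x => R σ x.unpair.1 x.unpair.2, ?_, ?_, ?_⟩
    · have hu1 : Primrec fun p : List ℕ × ℕ => p.2.unpair.1 :=
        Primrec.fst.comp (Primrec.unpair.comp Primrec.snd)
      have hu2 : Primrec fun p : List ℕ × ℕ => p.2.unpair.2 :=
        Primrec.snd.comp (Primrec.unpair.comp Primrec.snd)
      refine Primrec.nat_rec' (h := fun p q => q.2.bind fun i =>
        H p.1 (Nat.pair p.2.unpair.1 (Nat.pair q.1 i))) hu2 (hF.comp Primrec.fst hu1) ?_
      refine Primrec.option_bind (Primrec.snd.comp Primrec.snd) ?_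
      refine hH.comp (Primrec.fst.comp (Primrec.fst.comp Primrec.fst))
        (Primrec₂.natPair.comp (hu1.comp (Primrec.fst.comp Primrec.fst))
          (Primrec₂.natPair.comp (Primrec.fst.comp (Primrec.snd.comp Primrec.fst)) Primrec.snd))
    · exact fun σ τ x y hστ => mR _ _ _ _ _ hστ
    · intro x y
      simp only
      generalize x.unpair.1 = a
      generalize x.unpair.2 = n
      induction n generalizing y with
      | zero => exact eF a y
      | succ n ih =>
        simp only [R, Option.bind_eq_some_iff, Part.bind_eq_bind, Part.mem_bind_iff, eH] at ih ⊢
        simp only [ih]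
        constructor
        · rintro ⟨i, ⟨k, hi⟩, m, hy⟩
          exact ⟨max k m, i, mR _ _ a n _ (initSeg_prefix g (le_max_left _ _)) hi,
            mH _ _ _ _ (initSeg_prefix g (le_max_right _ _)) hy⟩
        · rintro ⟨k, i, hi, hy⟩
          exact ⟨i, ⟨k, hi⟩, k, hy⟩
  | @rfind f _ ihf =>
    obtain ⟨F, hF, mF, eF⟩ := ihf
    -- The default `0` makes the search stop at an undefined value as well as at a zero; `S` then
    -- answers only if the value found is really `0`. A search that finds nothing returns
    -- `σ.length`, whence the bound `m ≤ σ.length` in `hS`.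
    let idx : List ℕ → ℕ → ℕ := fun σ x => (List.range σ.length).findIdx fun m =>
      decide ((F σ (Nat.pair x m)).getD 0 = 0)
    let S : List ℕ → ℕ → Option ℕ := fun σ x =>
      if F σ (Nat.pair x (idx σ x)) = some 0 then some (idx σ x) else none
    have hS : ∀ σ x m, S σ x = some m ↔ m ≤ σ.length ∧ F σ (Nat.pair x m) = some 0 ∧
        ∀ j < m, ∃ v, v ≠ 0 ∧ F σ (Nat.pair x j) = some v := by
      intro σ x m
      have key : ∀ j, (F σ (Nat.pair x j)).getD 0 ≠ 0 ↔
          ∃ v, v ≠ 0 ∧ F σ (Nat.pair x j) = some v := by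
        intro j
        cases F σ (Nat.pair x j) <;> simp
      simp only [S, ← key]
      constructor
      · intro h
        split_ifs at h with h0
        obtain rfl : idx σ x = m := by simpa using h
        refine ⟨by simpa [idx] using List.findIdx_le_length (xs := List.range σ.length), h0, ?_⟩
        intro j hj
        have := List.not_of_lt_findIdx hj
        simpa using this
      · rintro ⟨h1, h2, h3⟩
        have : idx σ x = m := by
          rcases h1.lt_or_eq with h | h
          · refine (List.findIdx_eq (by simpa using h)).2 ⟨by simp [h2], fun j hj => ?_⟩
            simpa using h3 j hj
          · have : idx σ x = (List.range σ.length).length := by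
              refine List.findIdx_eq_length.2 fun j hj => ?_
              simpa using h3 j (by simpa [h] using hj)
            simpa [h] using this
        rw [this, if_pos h2]
    refine ⟨S, ?_, ?_, ?_⟩
    · have hidx : Primrec₂ idx := by
        refine Primrec.list_findIdx (Primrec.list_range.comp
          (Primrec.list_length.comp Primrec.fst)) ?_
        refine PrimrecPred.decide (PrimrecRel.comp Primrec.eq (Primrec.option_getD.comp
          (hF.comp (Primrec.fst.comp Primrec.fst) (Primrec₂.natPair.comp
            (Primrec.snd.comp Primrec.fst) Primrec.snd)) (Primrec.const 0)) (Primrec.const 0))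
      refine Primrec.ite (PrimrecRel.comp Primrec.eq (hF.comp Primrec.fst
        (Primrec₂.natPair.comp Primrec.snd hidx)) (Primrec.const _))
        (Primrec.option_some.comp hidx) (Primrec.const _)
    · intro σ τ x y hστ
      simp only [hS]
      rintro ⟨h1, h2, h3⟩
      refine ⟨h1.trans hστ.length_le, mF _ _ _ _ hστ h2, fun j hj => ?_⟩
      obtain ⟨v, hv, h⟩ := h3 j hj
      exact ⟨v, hv, mF _ _ _ _ hστ h⟩
    · intro x m
      refine Nat.mem_rfind.trans ?_
      simp only [hS, Part.map_eq_map, Part.mem_map_iff, length_initSeg]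
      constructor
      · rintro ⟨⟨v, hv, hv0⟩, hlt⟩
        obtain rfl : v = 0 := by simpa using hv0
        have : ∀ j, ∃ n, j < m → ∃ v, v ≠ 0 ∧ F (initSeg g n) (Nat.pair x j) = some v := by
          intro j
          by_cases hj : j < m
          · obtain ⟨v, hv, hv0⟩ := hlt hj
            obtain ⟨n, hn⟩ := (eF _ _).1 hv
            exact ⟨n, fun _ => ⟨v, by simpa using hv0, hn⟩⟩
          · exact ⟨0, fun h => absurd h hj⟩
        choose n hn using this
        obtain ⟨n0, hn0⟩ := (eF _ _).1 hv
        -- Large enough for the bound on `m`, for the zero at `m`, and for the nonzero values at all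
        -- `j < m`.
        let N := max (max m n0) ((Finset.range m).sup n)
        refine ⟨N, (le_max_left _ _).trans (le_max_left _ _), mF _ _ _ _ (initSeg_prefix g
          ((le_max_right _ _).trans (le_max_left _ _))) hn0, fun j hj => ?_⟩
        obtain ⟨v, hv, h⟩ := hn j hj
        exact ⟨v, hv, mF _ _ _ _ (initSeg_prefix g ((Finset.le_sup (f := n)
          (Finset.mem_range.2 hj)).trans (le_max_right _ _))) h⟩
      · rintro ⟨n, -, h2, h3⟩
        refine ⟨⟨0, (eF _ _).2 ⟨n, h2⟩, by simp⟩, fun {j} hj => ?_⟩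
        obtain ⟨v, hv, h⟩ := h3 j hj
        exact ⟨v, (eF _ _).2 ⟨n, h⟩, by simpa using hv⟩

/-- A computable function is determined by any code for it. This serves twice: to list all
reductions, and to see that there are countably many computable structures. -/
theorem countable_computable (α σ : Type*) [Primcodable α] [Primcodable σ] :
    Countable {f : α → σ // Computable f} := by
  choose c hc using fun f : {f : α → σ // Computable f} => Nat.Partrec.Code.exists_code.1 f.2
  refine Function.Injective.countable (f := c) fun f f' h => ?_
  have := (hc f).symm.trans ((congrArg _ h).trans (hc f'))
  refine Subtype.ext (funext fun a => ?_)
  have := congrFun this (Encodable.encode a)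
  simpa using this

/-! ### Finite joins and cone avoidance -/

/-- The join of the first `n` of a sequence of functions. -/
def join (a : ℕ → ℕ → ℕ) (n j : ℕ) : ℕ :=
  if j.unpair.1 < n then a j.unpair.1 j.unpair.2 else 0

/-- Only finitely many columns are nonzero, so the reductions need not be uniform in `i`: they are
combined one at a time by a case distinction. -/
theorem Red.join {a : ℕ → ℕ → ℕ} {n : ℕ} {g : ℕ → ℕ} (h : ∀ i < n, Red (a i) g) :
    Red (join a n) g := by
  induction n with
  | zero =>
    refine (Red.of_computable (Computable.const 0) g).of_eq fun x => ?_
    simp [CompStr.join]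
  | succ n ih =>
    have hu1 : Computable fun p : ℕ => p.unpair.1 := Computable.fst.comp Computable.unpair
    have hu2 : Computable fun p : ℕ => p.unpair.2 := Computable.snd.comp Computable.unpair
    have hG : Primrec fun p : ℕ × ℕ × ℕ => if p.1 = n then p.2.1 else p.2.2 :=
      Primrec.ite (PrimrecRel.comp Primrec.eq Primrec.fst (Primrec.const n))
        (Primrec.fst.comp Primrec.snd) (Primrec.snd.comp Primrec.snd)
    refine (Red.comp₃ (G := fun c u v => if c = n then u else v) hG.to_comp
      (Red.of_computable hu1 g) ((h n n.lt_succ_self).comp (Red.of_computable hu2 g))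
      (ih fun i hi => h i (hi.trans n.lt_succ_self))).of_eq fun x => ?_
    simp only [CompStr.join, Order.lt_add_one_iff, PFun.coe_val]
    congr 1
    rcases lt_trichotomy x.unpair.1 n with h | h | h
    · simp [h, h.le, h.ne]
    · simp [h]
    · simp [h.not_gt, h.not_ge, h.ne']

/-- A function agreeing with a column of `g` from some point on is reducible to `g`. -/
theorem Red.of_eventually_column {f g : ℕ → ℕ} (i m : ℕ)
    (h : ∀ x, m ≤ Nat.pair i x → f x = g (Nat.pair i x)) : Red f g := by
  have hp : Primrec fun x : ℕ => Nat.pair i x := Primrec₂.natPair.comp (Primrec.const i) Primrec.id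
  have hG : Primrec₂ fun x v : ℕ => ((CompStr.initSeg f m)[x]?).getD v :=
    Primrec.option_getD.comp (Primrec.list_getElem?.comp (Primrec.const _) Primrec.fst) Primrec.snd
  refine (Red.comp₂ hG.to_comp (Red.of_computable Computable.id g)
    ((Red.refl g).comp (Red.of_computable hp.to_comp g))).of_eq fun x => ?_
  simp only [PFun.coe_val, initSeg_getElem?, id]
  congr 1
  split_ifs with hx
  · rfl
  · exact (h x ((not_lt.1 hx).trans (Nat.right_le_pair i x))).symm

/-- `τ` extends `σ`, and its new entries agree with `A` on the first `n` columns. -/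
def GoodExt (A : ℕ → ℕ) (n : ℕ) (σ τ : List ℕ) : Prop :=
  σ <+: τ ∧ ∀ j < τ.length, σ.length ≤ j → j.unpair.1 < n → τ[j]? = some (A j)

/-- The test for good extensions, with the oracle `A` replaced by a finite list `L` of its values.
-/
theorem primrec_check (σ : List ℕ) (n : ℕ) : PrimrecRel fun ρ L : List ℕ =>
    ρ.take σ.length = σ ∧ ∀ j < ρ.length, σ.length ≤ j → j.unpair.1 < n → ρ[j]? = L[j]? := by
  refine PrimrecPred.and (PrimrecRel.comp Primrec.eq
    (Primrec.list_take.comp (Primrec.const _) Primrec.fst) (Primrec.const σ)) ?_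
  have hR : PrimrecRel fun (j : ℕ) (q : List ℕ × List ℕ) =>
      (¬ σ.length ≤ j ∨ ¬ j.unpair.1 < n) ∨ q.1[j]? = q.2[j]? := by
    refine PrimrecPred.or (PrimrecPred.or ?_ ?_) ?_
    · exact (PrimrecRel.comp Primrec.nat_le (Primrec.const _) Primrec.fst).not
    · exact (PrimrecRel.comp Primrec.nat_lt (Primrec.fst.comp (Primrec.unpair.comp Primrec.fst))
        (Primrec.const _)).not
    · exact PrimrecRel.comp Primrec.eq
        (Primrec.list_getElem?.comp (Primrec.fst.comp Primrec.snd) Primrec.fst)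
        (Primrec.list_getElem?.comp (Primrec.snd.comp Primrec.snd) Primrec.fst)
  refine (PrimrecRel.comp hR.forall_mem_list
    (f := fun p : List ℕ × List ℕ => List.range p.1.length) (g := fun p => p)
    (Primrec.list_range.comp (Primrec.list_length.comp Primrec.fst)) Primrec.id).of_eq fun p => ?_
  simp only [List.mem_range]
  exact forall_congr' fun j => imp_congr_right fun _ => by tauto

/-- If `g` computes `d` through `F`, and no good extension of `σ` makes `F` disagree with `d`, then
`d` is computable from the columns that good extensions have to respect. -/
theorem red_of_goodExt_agree {A d g : ℕ → ℕ} {n : ℕ} {σ : List ℕ} {F : List ℕ → ℕ → Option ℕ}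
    (hF : Computable₂ F) (hmono : ∀ σ τ x y, σ <+: τ → F σ x = some y → F τ x = some y)
    (hσ : initSeg g σ.length = σ)
    (hg : ∀ j, σ.length ≤ j → j.unpair.1 < n → g j = A j)
    (hd : ∀ x, ∃ m, F (initSeg g m) x = some (d x))
    (hagree : ∀ τ x y, GoodExt A n σ τ → F τ x = some y → y = d x) : Red d A := by
  classical
  -- The length of the oracle segment `L` is decoded as a candidate `ρ`, so reading longer and
  -- longer segments of `A` searches through all lists.
  let F' : List ℕ → ℕ → Option ℕ := fun L x =>
    (Encodable.decode (α := List ℕ) L.length).bind fun ρ =>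
      if ρ.take σ.length = σ ∧ ∀ j < ρ.length, σ.length ≤ j → j.unpair.1 < n → ρ[j]? = L[j]?
      then F ρ x else none
  have hF' : Computable₂ F' := by
    refine Computable.option_bind (Computable.decode.comp
      (Computable.list_length.comp Computable.fst)) ?_
    have hc := ((primrec_check σ n).comp (Primrec.snd (α := List ℕ × ℕ))
      (Primrec.fst.comp Primrec.fst)).decide.to_comp
    refine (Computable.cond hc (hF.comp Computable.snd (Computable.snd.comp Computable.fst))
      (Computable.const none)).of_eq fun p => ?_
    exact Bool.cond_decide _ _ _
  refine red_of_approx hF' (fun x => ?_) (fun x N y h => ?_)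
  · obtain ⟨m, hm⟩ := hd x
    let ρ := initSeg g (max m σ.length)
    refine ⟨Encodable.encode ρ, d x, ?_⟩
    -- A list is no longer than its code, so the segment of `A` whose length is the code of `ρ`
    -- covers every position at which `ρ` has to be tested.
    have hle : max m σ.length ≤ Encodable.encode ρ := by
      simpa [ρ] using Encodable.length_le_encode ρ
    simp only [F', length_initSeg, Encodable.encodek, Option.bind_some]
    rw [if_pos, hmono _ _ _ _ (initSeg_prefix g (le_max_left _ _)) hm]
    refine ⟨?_, fun j hj h1 h2 => ?_⟩
    · have := initSeg_prefix g (le_max_right m σ.length)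
      rw [hσ] at this
      exact (List.prefix_iff_eq_take.1 this).symm
    · have hj' : j < max m σ.length := by simpa [ρ] using hj
      rw [initSeg_getElem?, initSeg_getElem?, if_pos hj', if_pos (hj'.trans_le hle), hg j h1 h2]
  · simp only [F', length_initSeg, Option.bind_eq_some_iff] at h
    obtain ⟨ρ, hρ, h⟩ := h
    split_ifs at h with hc
    refine hagree ρ x y ⟨List.prefix_iff_eq_take.2 hc.1.symm, fun j hj h1 h2 => ?_⟩ h
    have := hc.2 j hj h1 h2
    rw [initSeg_getElem?] at this
    split_ifs at this with hjN
    · exact this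
    · simp at this; omega

theorem goodExt_snoc {A : ℕ → ℕ} {n : ℕ} {σ τ : List ℕ} (h : GoodExt A n σ τ) :
    GoodExt A n σ (τ ++ [A τ.length]) := by
  refine ⟨h.1.trans (List.prefix_append _ _), fun j hj h1 h2 => ?_⟩
  rcases Nat.lt_succ_iff_lt_or_eq.1 (by simpa using hj : j < τ.length + 1) with hj | rfl
  · rw [List.getElem?_append_left hj, h.2 j hj h1 h2]
  · simp

theorem goodExt_refl (A : ℕ → ℕ) (n : ℕ) (σ : List ℕ) : GoodExt A n σ σ :=
  ⟨List.prefix_rfl, fun _ h1 h2 => absurd h1 (not_lt.2 h2)⟩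

/-- A finite extension that diagonalizes against one reduction. -/
theorem exists_goodExt_diag {A d : ℕ → ℕ} {n : ℕ} (hdA : ¬ Red d A) (σ : List ℕ)
    {F : List ℕ → ℕ → Option ℕ} (hF : Computable₂ F) :
    ∃ τ, GoodExt A n σ τ ∧ σ.length < τ.length ∧ ∀ g : ℕ → ℕ, initSeg g τ.length = τ →
      (∀ j, τ.length ≤ j → j.unpair.1 < n → g j = A j) →
      (∀ σ τ x y, σ <+: τ → F σ x = some y → F τ x = some y) →
      ¬ ∀ x y, d x = y ↔ ∃ m, F (initSeg g m) x = some y := by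
  -- Either a good extension forces a wrong value, which then persists by monotonicity, or every
  -- value found on a good extension is correct; in the latter case a success of `F` along such a
  -- `g` would make `d` computable from `A`. In both cases one more entry is appended so that the
  -- length grows strictly.
  by_cases hc : ∃ τ x y, GoodExt A n σ τ ∧ F τ x = some y ∧ y ≠ d x
  · obtain ⟨τ, x, y, hτ, hy, hne⟩ := hc
    refine ⟨τ ++ [A τ.length], goodExt_snoc hτ, ?_, fun g hg _ hmono h => hne ?_⟩
    · have := hτ.1.length_le
      simp; omega
    · have hy' := hmono _ _ _ _ (List.prefix_append τ [A τ.length]) hy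
      rw [← hg] at hy'
      exact ((h x y).2 ⟨_, hy'⟩).symm
  · push Not at hc
    have hsn := goodExt_snoc (goodExt_refl A n σ)
    refine ⟨σ ++ [A σ.length], hsn, by simp, fun g hg hA hmono h => hdA ?_⟩
    have hlt : ∀ j < (σ ++ [A σ.length]).length, (σ ++ [A σ.length])[j]? = some (g j) := by
      intro j hj
      rw [← hg, initSeg_getElem?, if_pos hj]
    refine red_of_goodExt_agree hF hmono ?_ (fun j h1 h2 => ?_) (fun x => (h x _).1 rfl)
      (fun τ x y => hc τ x y)
    · have := initSeg_prefix g (m := σ.length) (n := (σ ++ [A σ.length]).length) (by simp)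
      rw [hg] at this
      exact (List.prefix_of_prefix_length_le this (List.prefix_append _ _)
        (by simp)).eq_of_length (by simp)
    · rcases lt_or_ge j (σ ++ [A σ.length]).length with hj | hj
      · have := (hlt j hj).symm.trans (hsn.2 j hj h1 h2)
        simpa using this
      · exact hA j hj h2

/-- Cone avoidance: an ascending sequence of functions none of which computes `d` has an upper
bound that does not compute `d`. -/
theorem exists_upper_bound_not_red {a : ℕ → ℕ → ℕ} {d : ℕ → ℕ} (h : ∀ n, ¬ Red d (join a n)) :
    ∃ e, (∀ i, Red (a i) e) ∧ ¬ Red d e := by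
  have := countable_computable (List ℕ × ℕ) (Option ℕ)
  have : Nonempty {f : List ℕ × ℕ → Option ℕ // Computable f} := ⟨⟨_, Computable.const none⟩⟩
  obtain ⟨Φ, hΦ⟩ := exists_surjective_nat {f : List ℕ × ℕ → Option ℕ // Computable f}
  -- Stage `s` defeats the reduction `Φ s` and lets the new entries in the columns below `s` copy
  -- `a`. Hence column `i` agrees with `a i` on all entries added from stage `i + 1` on.
  choose next hgood hlen hdiag using fun s σ => exists_goodExt_diag (n := s) (h s) σ
    (F := fun σ x => (Φ s).1 (σ, x)) (Φ s).2
  let σ : ℕ → List ℕ := fun s => Nat.rec [] next s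
  have hσs : ∀ s, σ (s + 1) = next s (σ s) := fun s => rfl
  have hlt : ∀ s, (σ s).length < (σ (s + 1)).length := fun s => hlen s (σ s)
  have hpre : ∀ s t, s ≤ t → σ s <+: σ t := by
    intro s t hst
    induction hst with
    | refl => exact List.prefix_rfl
    | step _ ih => exact ih.trans (hgood _ _).1
  have hge : ∀ s, s ≤ (σ s).length := by
    intro s
    induction s with
    | zero => simp
    | succ s ih => exact Nat.succ_le_of_lt (ih.trans_lt (hlt s))
  -- The default is never used: by `hge`, `σ (j + 1)` has more than `j` entries.
  let e : ℕ → ℕ := fun j => ((σ (j + 1))[j]?).getD 0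
  have he : ∀ s j, j < (σ s).length → (σ s)[j]? = some (e j) := by
    intro s j hj
    have hj' : j < (σ (j + 1)).length := hge (j + 1)
    have h1 : ∀ s t, s ≤ t → j < (σ s).length → (σ t)[j]? = (σ s)[j]? := by
      intro s t hst hj
      obtain ⟨ρ, hρ⟩ := hpre s t hst
      rw [← hρ, List.getElem?_append_left hj]
    have h2 : (σ s)[j]? = (σ (j + 1))[j]? := by
      rcases le_total s (j + 1) with hs | hs
      · exact (h1 _ _ hs hj).symm
      · exact h1 _ _ hs hj'
    rw [h2]
    simp [e, hj']
  have hcol : ∀ s j, (σ s).length ≤ j → j.unpair.1 < s → e j = a j.unpair.1 j.unpair.2 := by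
    intro s j hsj hj
    -- The stage `t` at which entry `j` is added.
    obtain ⟨t, ht⟩ : ∃ t, s ≤ t ∧ (σ t).length ≤ j ∧ j < (σ (t + 1)).length := by
      have hP : ∃ t, j < (σ t).length := ⟨j + 1, hge (j + 1)⟩
      classical
      have h1 := Nat.find_spec hP
      have hs : s < Nat.find hP := by
        by_contra hs
        exact absurd ((hpre _ _ (not_lt.1 hs)).length_le) (not_le.2 (hsj.trans_lt h1))
      obtain ⟨t, ht⟩ := Nat.exists_eq_succ_of_ne_zero (Nat.ne_zero_of_lt hs)
      refine ⟨t, by omega, not_lt.1 (Nat.find_min hP (by omega)), ?_⟩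
      rw [ht] at h1
      exact h1
    have := (hgood t (σ t)).2 j (by simpa [hσs] using ht.2.2) ht.2.1 (hj.trans_le ht.1)
    rw [← hσs, he (t + 1) j ht.2.2] at this
    simpa [join, hj.trans_le ht.1] using this
  refine ⟨e, fun i => Red.of_eventually_column i (σ (i + 1)).length fun x hx => ?_, fun hde => ?_⟩
  · simpa using (hcol (i + 1) (Nat.pair i x) hx (by simp)).symm
  · obtain ⟨F, hF, hmono, hFd⟩ := exists_approx hde
    obtain ⟨s, hs⟩ := hΦ ⟨fun p => F p.1 p.2, hF.to_comp⟩
    have hsF : ∀ σ x, (Φ s).1 (σ, x) = F σ x := fun σ x => by rw [hs]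
    have hd := hdiag s (σ s) e ?_ ?_ ?_
    · refine hd fun x y => ?_
      simpa [hsF, eq_comm] using hFd x y
    · refine List.ext_getElem? fun j => ?_
      rw [initSeg_getElem?, ← hσs]
      split_ifs with hj
      · exact (he (s + 1) j hj).symm
      · simpa using hj
    · intro j h1 h2
      rw [← hσs] at h1
      simpa [join, h2] using hcol (s + 1) j h1 (h2.trans s.lt_succ_self)
    · simpa only [hsF] using hmono

variable {L : CompLanguage}

theorem list_map_eq_self {α : Type*} {f : α → α} {l : List α} (h : ∀ x ∈ l, f x = x) :
    l.map f = l :=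
  (List.map_congr_left h).trans (List.map_id l)

/-! ### Closure properties of computable predicates -/

section ComputablePred

variable {α β : Type*} [Primcodable α] [Primcodable β]

theorem computablePred_comp {p : β → Prop} (hp : ComputablePred p) {f : α → β}
    (hf : Computable f) : ComputablePred fun a => p (f a) := by
  classical
  exact ComputablePred.computable_iff.2 ⟨_, hp.decide.comp hf, by simp⟩

theorem computablePred_and {p q : α → Prop} (hp : ComputablePred p) (hq : ComputablePred q) :
    ComputablePred fun a => p a ∧ q a := by
  classical
  exact ComputablePred.computable_iff.2
    ⟨_, Primrec.and.to_comp.comp hp.decide hq.decide, by simp⟩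

theorem computablePred_or {p q : α → Prop} (hp : ComputablePred p) (hq : ComputablePred q) :
    ComputablePred fun a => p a ∨ q a := by
  classical
  exact ComputablePred.computable_iff.2
    ⟨_, Primrec.or.to_comp.comp hp.decide hq.decide, by simp⟩

/-- The family `P` need not be uniformly computable: the bound `k` leaves finitely many cases, each
with its own decision procedure. -/
theorem computablePred_lt_and {P : ℕ → β → Prop} (hP : ∀ i, ComputablePred (P i)) {f : α → ℕ}
    {g : α → β} (hf : Computable f) (hg : Computable g) (k : ℕ) :
    ComputablePred fun a => f a < k ∧ P (f a) (g a) := by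
  induction k with
  | zero =>
    have h : ComputablePred fun _ : α => False :=
      ComputablePred.computable_iff.2 ⟨_, Computable.const false, by simp⟩
    exact h.of_eq (by simp)
  | succ k ih =>
    have h := (PrimrecRel.comp Primrec.eq Primrec.id (Primrec.const k)).computablePred
    refine (computablePred_or ih (computablePred_and (computablePred_comp h hf)
      (computablePred_comp (hP k) hg))).of_eq fun a => ?_
    rw [Nat.lt_succ_iff_lt_or_eq, or_and_right]
    exact or_congr Iff.rfl (and_congr_right fun h => by rw [show f a = k from h])

theorem countable_computablePred (α : Type*) [Primcodable α] :
    Countable {p : α → Prop // ComputablePred p} := by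
  classical
  have := countable_computable α Bool
  refine Function.Injective.countable
    (f := fun p : {p : α → Prop // ComputablePred p} =>
      (⟨fun a => decide (p.1 a), p.2.decide⟩ : {f : α → Bool // Computable f})) ?_
  intro p q h
  refine Subtype.ext (funext fun a => propext ?_)
  simpa using congrFun (congrArg Subtype.val h) a

end ComputablePred

/-! ### Diagrams -/

section RawDiagrams

variable {S T : Set ℕ}

/-- The graph of the interpretation of the `j`-th function symbol. -/
def FunGraph (str : L.toLanguage.Structure S) (j : ℕ) (l : List ℕ) (y : ℕ) : Prop :=
  ∃ (n : ℕ) (h : L.funArity j = some n) (v : Fin n → S),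
    l = List.ofFn (fun i => (v i : ℕ)) ∧ (str.funMap ⟨j, h⟩ v : ℕ) = y

/-- The interpretation of the `j`-th relation symbol. -/
def RelGraph (str : L.toLanguage.Structure S) (j : ℕ) (l : List ℕ) : Prop :=
  ∃ (n : ℕ) (h : L.relArity j = some n) (v : Fin n → S),
    l = List.ofFn (fun i => (v i : ℕ)) ∧ str.RelMap ⟨j, h⟩ v

/-- The atomic diagram of a structure as a family of relations: the universe, the graphs of the
functions, and the relations. -/
def RawDiag (str : L.toLanguage.Structure S) (m : ℕ) (l : List ℕ) : Prop :=
  (m.unpair.1 = 0 ∧ ∃ x ∈ S, l = [x]) ∨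
  (m.unpair.1 = 1 ∧ ∃ v y, l = v ++ [y] ∧ FunGraph str m.unpair.2 v y) ∨
  (m.unpair.1 = 2 ∧ RelGraph str m.unpair.2 l)

theorem funGraph_ofFn (str : L.toLanguage.Structure S) {j n : ℕ} (h : L.funArity j = some n)
    (v : Fin n → S) (y : ℕ) :
    FunGraph str j (List.ofFn fun i => (v i : ℕ)) y ↔ (str.funMap ⟨j, h⟩ v : ℕ) = y := by
  refine ⟨?_, fun hy => ⟨n, h, v, rfl, hy⟩⟩
  rintro ⟨n', h', v', hv, hy⟩
  obtain rfl : n = n' := Option.some.inj (h.symm.trans h')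
  have := List.ofFn_injective hv
  obtain rfl : v = v' := funext fun i => Subtype.ext (congrFun this i)
  exact hy

theorem relGraph_ofFn (str : L.toLanguage.Structure S) {j n : ℕ} (h : L.relArity j = some n)
    (v : Fin n → S) :
    RelGraph str j (List.ofFn fun i => (v i : ℕ)) ↔ str.RelMap ⟨j, h⟩ v := by
  refine ⟨?_, fun hy => ⟨n, h, v, rfl, hy⟩⟩
  rintro ⟨n', h', v', hv, hy⟩
  obtain rfl : n = n' := Option.some.inj (h.symm.trans h')
  have := List.ofFn_injective hv
  obtain rfl : v = v' := funext fun i => Subtype.ext (congrFun this i)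
  exact hy

@[simp] theorem rawDiag_zero (str : L.toLanguage.Structure S) (j : ℕ) (l : List ℕ) :
    RawDiag str (Nat.pair 0 j) l ↔ ∃ x ∈ S, l = [x] := by
  simp [RawDiag]

@[simp] theorem rawDiag_one (str : L.toLanguage.Structure S) (j : ℕ) (l : List ℕ) :
    RawDiag str (Nat.pair 1 j) l ↔ ∃ v y, l = v ++ [y] ∧ FunGraph str j v y := by
  simp [RawDiag]

theorem rawDiag_one_append (str : L.toLanguage.Structure S) (j : ℕ) (v : List ℕ) (y : ℕ) :
    RawDiag str (Nat.pair 1 j) (v ++ [y]) ↔ FunGraph str j v y := by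
  rw [rawDiag_one]
  refine ⟨?_, fun h => ⟨v, y, rfl, h⟩⟩
  rintro ⟨v', y', h, h'⟩
  obtain ⟨rfl, h⟩ := List.append_inj' h rfl
  obtain rfl : y = y' := by simpa using h
  exact h'

@[simp] theorem rawDiag_two (str : L.toLanguage.Structure S) (j : ℕ) (l : List ℕ) :
    RawDiag str (Nat.pair 2 j) l ↔ RelGraph str j l := by
  simp [RawDiag]

theorem RawDiag.mem {str : L.toLanguage.Structure S} {m : ℕ} {l : List ℕ} (h : RawDiag str m l) :
    ∀ z ∈ l, z ∈ S := by
  rcases h with ⟨-, x, hx, rfl⟩ | ⟨-, v, y, rfl, n, h, v, rfl, rfl⟩ | ⟨-, n, h, v, rfl, -⟩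
  · simpa using hx
  · intro z hz
    simp only [List.mem_append, List.mem_ofFn, List.mem_singleton] at hz
    rcases hz with ⟨i, rfl⟩ | rfl
    · exact (v i).2
    · exact Subtype.property _
  · intro z hz
    obtain ⟨i, rfl⟩ := List.mem_ofFn.1 hz
    exact (v i).2

theorem RawDiag.map {sS : L.toLanguage.Structure S} {sT : L.toLanguage.Structure T}
    (e : S ≃[L.toLanguage] T) {t : ℕ → ℕ} (ht : ∀ x : S, t x = e x) {m : ℕ} {l : List ℕ}
    (h : RawDiag sS m l) : RawDiag sT m (l.map t) := by
  rcases h with ⟨hm, x, hx, rfl⟩ | ⟨hm, v, y, rfl, n, h, v, rfl, rfl⟩ | ⟨hm, n, h, v, rfl, hr⟩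
  · exact Or.inl ⟨hm, e ⟨x, hx⟩, Subtype.property _, by simp [← ht]⟩
  · refine Or.inr (Or.inl ⟨hm, _, _, List.map_append, ?_⟩)
    refine ⟨n, h, fun i => e (v i), ?_, ?_⟩
    · rw [List.map_ofFn]
      exact congrArg List.ofFn (funext fun i => ht (v i))
    · rw [ht]
      exact congrArg Subtype.val (e.map_fun ⟨_, h⟩ v).symm
  · refine Or.inr (Or.inr ⟨hm, n, h, fun i => e (v i), ?_, ?_⟩)
    · rw [List.map_ofFn]
      exact congrArg List.ofFn (funext fun i => ht (v i))
    · exact (e.map_rel ⟨_, h⟩ v).2 hr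

end RawDiagrams

/-- The atomic diagram of a computable structure. -/
def Diag (A : CompStructure L) (m : ℕ) (l : List ℕ) : Prop := RawDiag A.str m l

theorem Diag.mem {A : CompStructure L} {m : ℕ} {l : List ℕ} (h : Diag A m l) :
    ∀ z ∈ l, z ∈ A.dom := RawDiag.mem h

theorem computablePred_rawDiag {S : Set ℕ} {str : L.toLanguage.Structure S}
    (hS : ComputablePred fun x => x ∈ S)
    (hf : ComputablePred fun p : ℕ × List ℕ × ℕ => FunGraph str p.1 p.2.1 p.2.2)
    (hr : ComputablePred fun p : ℕ × List ℕ => RelGraph str p.1 p.2) :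
    ComputablePred fun p : ℕ × List ℕ => RawDiag str p.1 p.2 := by
  classical
  have kind : ∀ c : ℕ, ComputablePred fun p : ℕ × List ℕ => p.1.unpair.1 = c := fun c =>
    (PrimrecRel.comp Primrec.eq (Primrec.fst.comp (Primrec.unpair.comp Primrec.fst))
      (Primrec.const c)).computablePred
  have hsym : Computable fun p : ℕ × List ℕ => p.1.unpair.2 :=
    Computable.snd.comp (Computable.unpair.comp Computable.fst)
  refine computablePred_or (computablePred_and (kind 0) ?_)
    (computablePred_or (computablePred_and (kind 1) ?_) (computablePred_and (kind 2) ?_))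
  · have hhead : Computable fun p : ℕ × List ℕ => p.2.headI :=
      (Primrec.list_headI.comp Primrec.snd).to_comp
    have hlen : ComputablePred fun p : ℕ × List ℕ => p.2 = [p.2.headI] :=
      (PrimrecRel.comp Primrec.eq Primrec.snd (Primrec.list_cons.comp
        (Primrec.list_headI.comp Primrec.snd) (Primrec.const []))).computablePred
    refine (computablePred_and hlen (computablePred_comp hS hhead)).of_eq fun p => ?_
    constructor
    · rintro ⟨h1, h2⟩
      exact ⟨_, h2, h1⟩
    · rintro ⟨x, hx, h⟩
      simp [h, hx]
  · have hlast : Primrec fun p : ℕ × List ℕ => p.2.reverse.headI :=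
      Primrec.list_headI.comp (Primrec.list_reverse.comp Primrec.snd)
    have hinit : Primrec fun p : ℕ × List ℕ => p.2.reverse.tail.reverse :=
      Primrec.list_reverse.comp (Primrec.list_tail.comp (Primrec.list_reverse.comp Primrec.snd))
    have hlen : ComputablePred fun p : ℕ × List ℕ =>
        p.2 = p.2.reverse.tail.reverse ++ [p.2.reverse.headI] :=
      (PrimrecRel.comp Primrec.eq Primrec.snd (Primrec.list_append.comp hinit
        (Primrec.list_cons.comp hlast (Primrec.const [])))).computablePred
    refine (computablePred_and hlen (computablePred_comp hf (Computable.pair hsym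
      (Computable.pair hinit.to_comp hlast.to_comp)))).of_eq fun p => ?_
    constructor
    · rintro ⟨h1, h2⟩
      exact ⟨_, _, h1, h2⟩
    · rintro ⟨v, y, h, h'⟩
      simp [h, h']
  · exact computablePred_comp hr (Computable.pair hsym Computable.snd)

theorem computablePred_diag (A : CompStructure L) :
    ComputablePred fun p : ℕ × List ℕ => Diag A p.1 p.2 :=
  computablePred_rawDiag A.dom_computable A.funs_computable A.rels_computable

/-- The universe and the interpretations can be read off the diagram, and the remaining fields are
proofs. Together with the decidability of diagrams this bounds the number of computable structures.
-/
theorem diag_injective : Function.Injective (Diag : CompStructure L → ℕ → List ℕ → Prop) := by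
  rintro ⟨S, sS, h1, h2, h3⟩ ⟨T, sT, h4, h5, h6⟩ h
  have hd : ∀ m l, RawDiag sS m l ↔ RawDiag sT m l := fun m l =>
    iff_of_eq (congrFun (congrFun h m) l)
  obtain rfl : S = T := Set.ext fun x => by simpa using hd (Nat.pair 0 0) [x]
  obtain rfl : sS = sT := by
    refine FirstOrder.Language.Structure.ext ?_ ?_
    · funext n c v
      obtain ⟨j, hj⟩ := c
      have := (funGraph_ofFn sS hj v _).2 rfl
      rw [← rawDiag_one_append, hd, rawDiag_one_append, funGraph_ofFn sT hj] at this
      exact Subtype.ext this.symm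
    · funext n c v
      obtain ⟨j, hj⟩ := c
      have := hd (Nat.pair 2 j) (List.ofFn fun i => (v i : ℕ))
      rw [rawDiag_two, rawDiag_two, relGraph_ofFn sS hj, relGraph_ofFn sT hj] at this
      exact propext this
  rfl

instance : Countable (CompStructure L) := by
  have := countable_computablePred (ℕ × List ℕ)
  refine Function.Injective.countable (f := fun A : CompStructure L =>
    (⟨fun p => Diag A p.1 p.2, computablePred_diag A⟩ :
      {p : ℕ × List ℕ → Prop // ComputablePred p})) fun A B h => diag_injective ?_
  funext m l
  exact congrFun (congrArg Subtype.val h) (m, l)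

/-! ### Isomorphisms as functions on natural numbers -/

/-- `t` restricts to an isomorphism from `A` to `B`. -/
structure IsIsoFun (A B : CompStructure L) (t : ℕ → ℕ) : Prop where
  bijOn : Set.BijOn t A.dom B.dom
  diag_iff : ∀ m l, (∀ x ∈ l, x ∈ A.dom) → (Diag A m l ↔ Diag B m (l.map t))

theorem IsIsoFun.congr {A B : CompStructure L} {t t' : ℕ → ℕ} (h : IsIsoFun A B t)
    (ht : Set.EqOn t t' A.dom) : IsIsoFun A B t' := by
  refine ⟨h.bijOn.congr ht, fun m l hl => ?_⟩
  rw [h.diag_iff m l hl, List.map_congr_left fun x hx => ht (hl x hx)]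

theorem IsIsoFun.exists_lift {A B : CompStructure L} {t : ℕ → ℕ} (h : IsIsoFun A B t)
    {l : List ℕ} (hl : ∀ z ∈ l, z ∈ B.dom) : ∃ w : List ℕ, (∀ x ∈ w, x ∈ A.dom) ∧ l = w.map t := by
  refine ⟨l.map (Function.invFunOn t A.dom), ?_, ?_⟩
  · intro x hx
    obtain ⟨z, hz, rfl⟩ := List.mem_map.1 hx
    exact Function.invFunOn_mem (h.bijOn.surjOn (hl z hz))
  · rw [List.map_map]
    exact (list_map_eq_self fun z hz => Function.invFunOn_eq (h.bijOn.surjOn (hl z hz))).symm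

theorem isIsoFun_of_equiv {A B : CompStructure L} (f : Iso A B) {t : ℕ → ℕ}
    (ht : ∀ x : A.dom, t x = (f.toEquiv x : B.dom).val) : IsIsoFun A B t := by
  classical
  let t' : ℕ → ℕ := fun y => if h : y ∈ B.dom then (f.toEquiv.symm (⟨y, h⟩ : B.dom) : A.dom).val else 0
  have ht' : ∀ y : B.dom, t' y = (f.toEquiv.symm y : A.dom).val := fun y => dif_pos y.2
  have hl : ∀ x ∈ A.dom, t' (t x) = x := by
    intro x hx
    rw [ht ⟨x, hx⟩, ht' (f.toEquiv (⟨x, hx⟩ : A.dom) : B.dom)]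
    exact congrArg Subtype.val (f.toEquiv.symm_apply_apply (⟨x, hx⟩ : A.dom))
  have hr : ∀ y ∈ B.dom, t (t' y) = y := by
    intro y hy
    rw [ht' ⟨y, hy⟩, ht (f.toEquiv.symm (⟨y, hy⟩ : B.dom) : A.dom)]
    exact congrArg Subtype.val (f.toEquiv.apply_symm_apply (⟨y, hy⟩ : B.dom))
  have hm : ∀ x ∈ A.dom, t x ∈ B.dom := fun x hx => by
    rw [ht ⟨x, hx⟩]; exact Subtype.property _
  have hm' : ∀ y ∈ B.dom, t' y ∈ A.dom := fun y hy => by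
    rw [ht' ⟨y, hy⟩]; exact Subtype.property _
  refine ⟨⟨hm, fun x hx y hy h => ?_, fun y hy => ⟨t' y, hm' y hy, hr y hy⟩⟩, fun m l h => ?_⟩
  · rw [← hl x hx, h, hl y hy]
  · constructor
    · exact RawDiag.map (sS := A.str) (sT := B.str) f ht
    · intro hB
      have := RawDiag.map (sS := B.str) (sT := A.str) f.symm ht' hB
      rw [List.map_map, list_map_eq_self (f := t' ∘ t) fun x hx => hl x (h x hx)] at this
      exact this

theorem Iso.total_apply {A B : CompStructure L} (f : Iso A B) (x : A.dom) :
    f.total x = (f.toEquiv x : B.dom).val := dif_pos x.2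

theorem isIsoFun_total {A B : CompStructure L} (f : Iso A B) : IsIsoFun A B f.total :=
  isIsoFun_of_equiv f f.total_apply

theorem IsIsoFun.exists_iso {A B : CompStructure L} {t : ℕ → ℕ} (h : IsIsoFun A B t) :
    ∃ f : Iso A B, ∀ x ∈ A.dom, f.total x = t x := by
  let e : A.dom ≃ B.dom := h.bijOn.equiv t
  have he : ∀ x, (e x : ℕ) = t x := fun x => rfl
  let f : Iso A B :=
    { toEquiv := e
      map_fun' := by
        rintro n ⟨j, hj⟩ v
        let v' : Fin n → A.dom := v
        have h1 := (funGraph_ofFn A.str hj v' _).2 rfl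
        rw [← rawDiag_one_append] at h1
        have h2 := (h.diag_iff _ _ h1.mem).1 h1
        rw [Diag, List.map_append, List.map_ofFn, List.map_singleton, rawDiag_one_append] at h2
        exact Subtype.ext ((funGraph_ofFn B.str hj (fun i => e (v' i)) _).1 h2).symm
      map_rel' := by
        rintro n ⟨j, hj⟩ v
        let v' : Fin n → A.dom := v
        have h1 := h.diag_iff (Nat.pair 2 j) (List.ofFn fun i => (v' i : ℕ)) (by
          intro z hz
          obtain ⟨i, rfl⟩ := List.mem_ofFn.1 hz
          exact (v' i).2)
        rw [Diag, Diag, rawDiag_two, rawDiag_two, List.map_ofFn, relGraph_ofFn A.str hj] at h1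
        exact ((relGraph_ofFn B.str hj (fun i => e (v' i))).symm.trans h1.symm) }
  exact ⟨f, fun x hx => f.total_apply ⟨x, hx⟩⟩

theorem isCopy_iff {A B : CompStructure L} : IsCopy A B ↔ ∃ t, IsIsoFun A B t :=
  ⟨fun ⟨f⟩ => ⟨_, isIsoFun_total f⟩, fun ⟨_, h⟩ => let ⟨f, _⟩ := h.exists_iso; ⟨f⟩⟩

/-- Values off the universe of `A` are immaterial: the universe is computable, so they can be reset
to `0` without increasing the degree. -/
theorem deg_mem_isoSpec {A B : CompStructure L} {g : ℕ → ℕ} :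
    deg g ∈ IsoSpec A B ↔ ∃ t, IsIsoFun A B t ∧ Red t g := by
  classical
  constructor
  · rintro ⟨f, hf⟩
    exact ⟨_, isIsoFun_total f, deg_le_deg.1 hf⟩
  · rintro ⟨t, ht, hg⟩
    obtain ⟨f, hf⟩ := ht.exists_iso
    refine ⟨f, deg_le_deg.2 ?_⟩
    have hG : Computable₂ fun x y : ℕ => bif decide (x ∈ A.dom) then y else 0 :=
      Computable.cond (A.dom_computable.decide.comp Computable.fst) Computable.snd
        (Computable.const 0)
    refine (Red.comp₂ hG (Red.of_computable Computable.id g) hg).of_eq fun x => ?_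
    by_cases hx : x ∈ A.dom
    · simp [hx, hf x hx]
    · simp [hx, Iso.total]

/-- The image of a computable structure under an injective function is a computable structure if
its diagram is computable. -/
theorem exists_image {A : CompStructure L} {t : ℕ → ℕ} (ht : Set.InjOn t A.dom)
    {P : ℕ → List ℕ → Prop} (hP : ComputablePred fun p : ℕ × List ℕ => P p.1 p.2)
    (h : ∀ m l, P m l ↔ ∃ w, Diag A m w ∧ l = w.map t) :
    ∃ B : CompStructure L, IsIsoFun A B t ∧ ∀ m l, Diag B m l ↔ P m l := by
  classical
  let S : Set ℕ := t '' A.dom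
  let e : A.dom ≃ S := (Set.BijOn.equiv t ht.bijOn_image)
  let sA : L.toLanguage.Structure A.dom := A.str
  let sS : L.toLanguage.Structure S := e.inducedStructure
  let E : A.dom ≃[L.toLanguage] S := e.inducedStructureEquiv
  have hE : ∀ x : A.dom, t x = E x := fun x => rfl
  let t' : ℕ → ℕ := fun y => if h : y ∈ S then e.symm ⟨y, h⟩ else 0
  have ht' : ∀ y : S, t' y = E.symm y := fun y => dif_pos y.2
  have hr : ∀ y ∈ S, t (t' y) = y := by
    intro y hy
    rw [ht' ⟨y, hy⟩, hE]
    exact congrArg Subtype.val (E.apply_symm_apply ⟨y, hy⟩)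
  have key : ∀ m l, RawDiag sS m l ↔ P m l := by
    intro m l
    rw [h]
    constructor
    · intro hl
      refine ⟨l.map t', hl.map E.symm ht', ?_⟩
      rw [List.map_map, list_map_eq_self (f := t ∘ t') fun x hx => hr x (hl.mem x hx)]
    · rintro ⟨w, hw, rfl⟩
      exact RawDiag.map E hE hw
  have pair_const : ∀ c : ℕ, Primrec fun j : ℕ => Nat.pair c j := fun c =>
    Primrec₂.natPair.comp (Primrec.const c) Primrec.id
  let B : CompStructure L :=
    { dom := S
      str := sS
      dom_computable := by
        refine (computablePred_comp hP (f := fun x : ℕ => (Nat.pair 0 0, [x])) (Primrec.pair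
          (Primrec.const _) (Primrec.list_cons.comp Primrec.id (Primrec.const []))).to_comp).of_eq
            fun x => ?_
        rw [← key]
        simp
      funs_computable := by
        refine (computablePred_comp hP
          (f := fun p : ℕ × List ℕ × ℕ => (Nat.pair 1 p.1, p.2.1 ++ [p.2.2])) (Primrec.pair
            ((pair_const 1).comp Primrec.fst) (Primrec.list_append.comp
              (Primrec.fst.comp Primrec.snd) (Primrec.list_cons.comp (Primrec.snd.comp Primrec.snd)
                (Primrec.const [])))).to_comp).of_eq fun p => ?_
        exact (key _ _).symm.trans (rawDiag_one_append _ _ _ _)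
      rels_computable := by
        refine (computablePred_comp hP
          (f := fun p : ℕ × List ℕ => (Nat.pair 2 p.1, p.2)) (Primrec.pair
            ((pair_const 2).comp Primrec.fst) Primrec.snd).to_comp).of_eq fun p => ?_
        exact (key _ _).symm.trans (rawDiag_two _ _ _) }
  exact ⟨B, isIsoFun_of_equiv (A := A) (B := B) E hE, key⟩

/-! ### Disjoint unions -/

/-- The arity of the `m`-th relation of the diagram of a structure. -/
def diagArity (L : CompLanguage) (m : ℕ) : Option ℕ :=
  if m.unpair.1 = 0 then some 1
  else if m.unpair.1 = 1 then (L.funArity m.unpair.2).map Nat.succ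
  else if m.unpair.1 = 2 then L.relArity m.unpair.2
  else none

theorem computable_diagArity (L : CompLanguage) : Computable (diagArity L) := by
  have hk : Computable fun m : ℕ => m.unpair.1 := Computable.fst.comp Computable.unpair
  have hj : Computable fun m : ℕ => m.unpair.2 := Computable.snd.comp Computable.unpair
  have kind : ∀ c : ℕ, Computable fun m : ℕ => decide (m.unpair.1 = c) := fun c =>
    (PrimrecRel.comp Primrec.eq (Primrec.fst.comp Primrec.unpair)
      (Primrec.const c)).decide.to_comp
  have hs : Computable₂ fun _ n : ℕ => n.succ := Computable.succ.comp Computable.snd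
  refine (Computable.cond (kind 0) (Computable.const (some 1)) (Computable.cond (kind 1)
    (Computable.option_map (L.funArity_computable.comp hj) hs)
    (Computable.cond (kind 2) (L.relArity_computable.comp hj) (Computable.const none)))).of_eq
      fun m => ?_
  simp only [Bool.cond_decide, diagArity]

theorem Diag.arity {A : CompStructure L} {m : ℕ} {l : List ℕ} (h : Diag A m l) :
    diagArity L m = some l.length := by
  rcases h with ⟨hm, x, hx, rfl⟩ | ⟨hm, v, y, rfl, n, h, v, rfl, rfl⟩ | ⟨hm, n, h, v, rfl, -⟩
  · simp [diagArity, hm]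
  · simp [diagArity, hm, h]
  · simp [diagArity, hm, h]

/-- The language of disjoint unions of `L`-structures: the relation symbol `Nat.pair i m` is
interpreted by the `m`-th relation of the diagram of the `i`-th component. -/
def unionLanguage (L : CompLanguage) : CompLanguage where
  funArity _ := none
  relArity p := diagArity L p.unpair.2
  funArity_computable := Computable.const _
  relArity_computable := (computable_diagArity L).comp (Computable.snd.comp Computable.unpair)

/-- The universe of the disjoint union of `A 0, …, A (k - 1)`. -/
def unionDom (A : ℕ → CompStructure L) (k : ℕ) : Set ℕ :=
  {z | z.unpair.1 < k ∧ z.unpair.2 ∈ (A z.unpair.1).dom}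

/-- The relations of the disjoint union of `A 0, …, A (k - 1)`. -/
def UnionRel (A : ℕ → CompStructure L) (k p : ℕ) (l : List ℕ) : Prop :=
  p.unpair.1 < k ∧ (∀ z ∈ l, z.unpair.1 = p.unpair.1) ∧
    Diag (A p.unpair.1) p.unpair.2 (l.map fun z => z.unpair.2)

theorem unionRel_iff {A : ℕ → CompStructure L} {k i m : ℕ} {l : List ℕ} :
    UnionRel A k (Nat.pair i m) l ↔ i < k ∧ ∃ w, l = w.map (Nat.pair i) ∧ Diag (A i) m w := by
  simp only [UnionRel, Nat.unpair_pair]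
  refine and_congr_right fun _ => ⟨fun ⟨h1, h2⟩ => ⟨_, ?_, h2⟩, ?_⟩
  · rw [List.map_map, list_map_eq_self]
    intro z hz
    simp [← h1 z hz]
  · rintro ⟨w, rfl, hw⟩
    refine ⟨by simp, ?_⟩
    rwa [List.map_map, list_map_eq_self]
    simp

/-- The interpretation of the symbols in the disjoint union of `A 0, …, A (k - 1)`. -/
@[reducible] def unionStr (A : ℕ → CompStructure L) (k : ℕ) :
    (unionLanguage L).toLanguage.Structure (unionDom A k) where
  funMap c _ := nomatch c.2
  RelMap c v := UnionRel A k c.1 (List.ofFn fun i => (v i : ℕ))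

theorem relGraph_unionStr {A : ℕ → CompStructure L} {k p : ℕ} {l : List ℕ} :
    RelGraph (unionStr A k) p l ↔ UnionRel A k p l := by
  constructor
  · rintro ⟨n, h, v, rfl, hv⟩
    exact hv
  · intro h
    have hmem : ∀ z ∈ l, z ∈ unionDom A k := fun z hz => by
      refine ⟨(h.2.1 z hz).trans_lt h.1, ?_⟩
      rw [h.2.1 z hz]
      exact h.2.2.mem _ (List.mem_map_of_mem hz)
    have har : (unionLanguage L).relArity p = some l.length := by
      simpa [unionLanguage] using h.2.2.arity
    have hl : l = List.ofFn fun i : Fin l.length => l[i] := (List.ofFn_getElem (xs := l)).symm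
    refine ⟨l.length, har, fun i => ⟨l[i], hmem _ (List.getElem_mem _)⟩, hl, ?_⟩
    change UnionRel A k p (List.ofFn fun i : Fin l.length => l[i])
    rwa [← hl]

/-- The disjoint union of `A 0, …, A (k - 1)`. -/
def union (A : ℕ → CompStructure L) (k : ℕ) : CompStructure (unionLanguage L) where
  dom := unionDom A k
  str := unionStr A k
  dom_computable :=
    computablePred_lt_and (fun i => (A i).dom_computable)
      (Computable.fst.comp Computable.unpair) (Computable.snd.comp Computable.unpair) k
  funs_computable := by
    refine ComputablePred.of_eq (p := fun _ => False)
      (ComputablePred.computable_iff.2 ⟨_, Computable.const false, by simp⟩) fun p => ?_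
    refine ⟨False.elim, ?_⟩
    rintro ⟨n, h, -⟩
    exact nomatch h
  rels_computable := by
    have hi : Primrec fun p : ℕ × List ℕ => p.1.unpair.1 :=
      Primrec.fst.comp (Primrec.unpair.comp Primrec.fst)
    have hm : Primrec fun p : ℕ × List ℕ => p.1.unpair.2 :=
      Primrec.snd.comp (Primrec.unpair.comp Primrec.fst)
    have hl : Primrec fun p : ℕ × List ℕ => p.2.map fun z => z.unpair.2 :=
      Primrec.list_map Primrec.snd (Primrec.snd.comp (Primrec.unpair.comp Primrec.snd))
    have hR : PrimrecRel fun (z : ℕ) (p : ℕ × List ℕ) => z.unpair.1 = p.1.unpair.1 :=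
      PrimrecRel.comp Primrec.eq (Primrec.fst.comp (Primrec.unpair.comp Primrec.fst))
        (hi.comp Primrec.snd)
    have hall : ComputablePred fun p : ℕ × List ℕ => ∀ z ∈ p.2, z.unpair.1 = p.1.unpair.1 :=
      (PrimrecRel.comp hR.forall_mem_list (f := fun p : ℕ × List ℕ => p.2) (g := fun p => p)
        Primrec.snd Primrec.id).computablePred
    refine (computablePred_and hall (computablePred_lt_and (fun i => computablePred_diag (A i))
      hi.to_comp (hm.pair hl).to_comp k)).of_eq fun p => ?_
    refine Iff.trans ?_ relGraph_unionStr.symm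
    exact and_left_comm

theorem diag_union {A : ℕ → CompStructure L} {k i m : ℕ} {l : List ℕ} :
    Diag (union A k) (Nat.pair 2 (Nat.pair i m)) l ↔
      i < k ∧ ∃ w, l = w.map (Nat.pair i) ∧ Diag (A i) m w :=
  (rawDiag_two _ _ _).trans (relGraph_unionStr.trans unionRel_iff)

/-- Over a relational language, only the relations have to be preserved. -/
theorem isIsoFun_of_rel {A B : CompStructure (unionLanguage L)} {t : ℕ → ℕ}
    (hb : Set.BijOn t A.dom B.dom)
    (h : ∀ i m l, (∀ x ∈ l, x ∈ A.dom) → (Diag A (Nat.pair 2 (Nat.pair i m)) l ↔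
      Diag B (Nat.pair 2 (Nat.pair i m)) (l.map t))) : IsIsoFun A B t := by
  refine ⟨hb, fun m l hl => ?_⟩
  have hnf : ∀ {C : CompStructure (unionLanguage L)} {j v y}, ¬ FunGraph C.str j v y := by
    rintro C j v y ⟨n, h, -⟩
    exact nomatch h
  by_cases hm : m.unpair.1 = 2
  · have := h m.unpair.2.unpair.1 m.unpair.2.unpair.2 l hl
    rwa [Nat.pair_unpair, ← hm, Nat.pair_unpair] at this
  -- Without function symbols, what remains besides the relations is the universe, which any
  -- bijection respects.
  · simp only [Diag, RawDiag, hm, hnf, false_and, and_false, exists_false, or_false]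
    refine and_congr_right fun _ => ⟨?_, ?_⟩
    · rintro ⟨x, hx, rfl⟩
      exact ⟨t x, hb.mapsTo hx, rfl⟩
    · rintro ⟨y, -, hl'⟩
      obtain ⟨x, rfl, -⟩ := List.map_eq_singleton_iff.1 hl'
      exact ⟨x, hl x (by simp), rfl⟩

/-- `C` is the disjoint union of the images of `B 0, …, B (k - 1)` under the computable injections
`c 0, …, c (k - 1)`, which have the computable left inverse `r`. -/
structure Decomp (C : CompStructure (unionLanguage L)) (B : ℕ → CompStructure L) (k : ℕ)
    (c : ℕ → ℕ → ℕ) (r : ℕ → ℕ) : Prop where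
  computable_incl : Computable₂ c
  computable_retr : Computable r
  mem : ∀ i < k, ∀ y ∈ (B i).dom, c i y ∈ C.dom
  retr : ∀ i < k, ∀ y ∈ (B i).dom, r (c i y) = y
  surj : ∀ z ∈ C.dom, ∃ i < k, ∃ y ∈ (B i).dom, c i y = z
  disj : ∀ i < k, ∀ i' < k, ∀ y ∈ (B i).dom, ∀ y' ∈ (B i').dom, c i y = c i' y' → i = i'
  rel : ∀ i m l, Diag C (Nat.pair 2 (Nat.pair i m)) l ↔
    i < k ∧ ∃ w, l = w.map (c i) ∧ Diag (B i) m w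

theorem mem_unionDom {A : ℕ → CompStructure L} {k i x : ℕ} (hi : i < k) (hx : x ∈ (A i).dom) :
    Nat.pair i x ∈ (union A k).dom := by
  change Nat.pair i x ∈ unionDom A k
  simp [unionDom, hi, hx]

theorem decomp_union (A : ℕ → CompStructure L) (k : ℕ) :
    Decomp (union A k) A k Nat.pair fun z => z.unpair.2 where
  computable_incl := Primrec₂.natPair.to_comp
  computable_retr := Computable.snd.comp Computable.unpair
  mem _ hi _ hx := mem_unionDom hi hx
  retr _ _ _ _ := by simp
  surj z hz := ⟨_, hz.1, _, hz.2, Nat.pair_unpair z⟩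
  disj _ _ _ _ _ _ _ _ h := (Nat.pair_eq_pair.1 h).1
  rel _ _ _ := diag_union

namespace Decomp

variable {A B : ℕ → CompStructure L} {C : CompStructure (unionLanguage L)} {k : ℕ}
  {c : ℕ → ℕ → ℕ} {r : ℕ → ℕ}

theorem map_retr (hC : Decomp C B k c r) {i : ℕ} (hi : i < k) {w : List ℕ}
    (hw : ∀ y ∈ w, y ∈ (B i).dom) : (w.map (c i)).map r = w := by
  rw [List.map_map]
  exact list_map_eq_self (f := r ∘ c i) fun y hy => hC.retr i hi y (hw y hy)

theorem diag_map_iff (hC : Decomp C B k c r) {i m : ℕ} (hi : i < k) {w : List ℕ}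
    (hw : ∀ y ∈ w, y ∈ (B i).dom) :
    Diag C (Nat.pair 2 (Nat.pair i m)) (w.map (c i)) ↔ Diag (B i) m w := by
  rw [hC.rel]
  refine ⟨?_, fun h => ⟨hi, w, rfl, h⟩⟩
  rintro ⟨-, w', h, hw'⟩
  have := congrArg (List.map r) h
  rw [hC.map_retr hi hw, hC.map_retr hi hw'.mem] at this
  rwa [this]

/-- Each relation symbol of the union belongs to one component and can only hold of tuples inside
it, so isomorphisms of the components may be chosen independently. -/
theorem isIsoFun_glue (hC : Decomp C B k c r) {h : ℕ → ℕ → ℕ}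
    (hh : ∀ i < k, IsIsoFun (A i) (B i) (h i)) :
    IsIsoFun (union A k) C fun z => c z.unpair.1 (h z.unpair.1 z.unpair.2) := by
  have hmem : ∀ z ∈ (union A k).dom, h z.unpair.1 z.unpair.2 ∈ (B z.unpair.1).dom := fun z hz =>
    (hh _ hz.1).bijOn.mapsTo hz.2
  have hdisj : ∀ z ∈ (union A k).dom, ∀ i < k, ∀ y ∈ (B i).dom,
      c z.unpair.1 (h z.unpair.1 z.unpair.2) = c i y → z.unpair.1 = i :=
    fun z hz i hi y hy h' => hC.disj _ hz.1 _ hi _ (hmem z hz) _ hy h'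
  refine isIsoFun_of_rel ⟨fun z hz => ?_, fun z hz z' hz' hzz' => ?_, fun y hy => ?_⟩ ?_
  · exact hC.mem _ hz.1 _ (hmem z hz)
  · have h1 := hdisj z hz _ hz'.1 _ (hmem z' hz') hzz'
    have h2 := congrArg r hzz'
    simp only [hC.retr _ hz.1 _ (hmem z hz), hC.retr _ hz'.1 _ (hmem z' hz')] at h2
    rw [← h1] at h2
    have h3 := (hh _ hz.1).bijOn.injOn hz.2 (by rw [h1]; exact hz'.2) h2
    rw [← Nat.pair_unpair z, ← Nat.pair_unpair z', h1, h3]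
  · obtain ⟨i, hi, u, hu, rfl⟩ := hC.surj y hy
    obtain ⟨x, hx, rfl⟩ := (hh i hi).bijOn.surjOn hu
    exact ⟨Nat.pair i x, mem_unionDom hi hx, by simp⟩
  · intro i m l hl
    have hmap : ∀ w : List ℕ, (w.map (Nat.pair i)).map
        (fun z => c z.unpair.1 (h z.unpair.1 z.unpair.2)) = (w.map (h i)).map (c i) := by
      intro w
      simp [Function.comp_def]
    constructor
    · intro hd
      obtain ⟨hi, w, rfl, hw⟩ := diag_union.1 hd
      rw [hmap]
      exact (hC.rel _ _ _).2 ⟨hi, _, rfl, ((hh i hi).diag_iff m w hw.mem).1 hw⟩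
    · intro hd
      obtain ⟨hi, w, hw, hdw⟩ := (hC.rel _ _ _).1 hd
      -- The image of each entry lies in the `i`-th part of `C`, and the parts are disjoint, so the
      -- entry comes from component `i`.
      have hcol : ∀ z ∈ l, z.unpair.1 = i := by
        intro z hz
        have : c z.unpair.1 (h z.unpair.1 z.unpair.2) ∈ w.map (c i) := by
          rw [← hw]
          exact List.mem_map_of_mem hz
        obtain ⟨y, hy, hyz⟩ := List.mem_map.1 this
        exact hdisj z (hl z hz) i hi y (hdw.mem y hy) hyz.symm
      have hl' : l = (l.map fun z => z.unpair.2).map (Nat.pair i) := by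
        rw [List.map_map, list_map_eq_self]
        intro z hz
        simp [← hcol z hz]
      have hx : ∀ x ∈ l.map (fun z => z.unpair.2), x ∈ (A i).dom := by
        intro x hx
        obtain ⟨z, hz, rfl⟩ := List.mem_map.1 hx
        rw [← hcol z hz]
        exact (hl z hz).2
      have hy : ∀ y ∈ (l.map fun z => z.unpair.2).map (h i), y ∈ (B i).dom := by
        intro y hy
        obtain ⟨x, hx', rfl⟩ := List.mem_map.1 hy
        exact (hh i hi).bijOn.mapsTo (hx x hx')
      rw [hl', hmap] at hw
      have hw' := congrArg (List.map r) hw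
      rw [hC.map_retr hi hy, hC.map_retr hi hdw.mem] at hw'
      rw [← hw'] at hdw
      exact diag_union.2 ⟨hi, _, hl', ((hh i hi).diag_iff m _ hx).2 hdw⟩

/-- The universe of each component is named by a relation symbol of its own, so `t` cannot permute
the components. -/
theorem isIsoFun_component (hC : Decomp C B k c r) {t : ℕ → ℕ} (ht : IsIsoFun (union A k) C t)
    {i : ℕ} (hi : i < k) : IsIsoFun (A i) (B i) fun x => r (t (Nat.pair i x)) := by
  have key : ∀ i < k, ∀ x ∈ (A i).dom, r (t (Nat.pair i x)) ∈ (B i).dom ∧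
      t (Nat.pair i x) = c i (r (t (Nat.pair i x))) := by
    intro i hi x hx
    -- `Nat.pair 0 0` indexes the universe in the diagram of a component.
    have h1 : Diag (union A k) (Nat.pair 2 (Nat.pair i (Nat.pair 0 0))) [Nat.pair i x] :=
      diag_union.2 ⟨hi, [x], rfl, (rawDiag_zero _ _ _).2 ⟨x, hx, rfl⟩⟩
    have h2 := (ht.diag_iff _ _ h1.mem).1 h1
    obtain ⟨-, w, hw, hd⟩ := (hC.rel _ _ _).1 h2
    obtain ⟨y, hy, rfl⟩ := (rawDiag_zero _ _ _).1 hd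
    have hty : t (Nat.pair i x) = c i y := by simpa using hw
    rw [hty, hC.retr i hi y hy]
    exact ⟨hy, rfl⟩
  refine ⟨⟨fun x hx => (key i hi x hx).1, fun x hx x' hx' h => ?_, fun y hy => ?_⟩, ?_⟩
  · have h' : t (Nat.pair i x) = t (Nat.pair i x') := by
      rw [(key i hi x hx).2, (key i hi x' hx').2]
      exact congrArg _ h
    exact (Nat.pair_eq_pair.1 (ht.bijOn.injOn (mem_unionDom hi hx) (mem_unionDom hi hx') h')).2
  · obtain ⟨z, hz, hzy⟩ := ht.bijOn.surjOn (hC.mem i hi y hy)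
    obtain ⟨i', hi', x, hx, rfl⟩ := (decomp_union A k).surj z hz
    have h1 := key i' hi' x hx
    have h2 := h1.2
    rw [hzy] at h2
    obtain rfl := hC.disj i hi i' hi' y hy _ (hzy ▸ h1.1) h2
    exact ⟨x, hx, by simp only [hzy, hC.retr i hi y hy]⟩
  · intro m l hl
    rw [← (decomp_union A k).diag_map_iff hi hl, ht.diag_iff, ← hC.diag_map_iff hi]
    · rw [List.map_map, List.map_map]
      exact iff_of_eq (congrArg _ (List.map_congr_left fun x hx => (key i hi x (hl x hx)).2))
    · intro y hy
      obtain ⟨x, hx, rfl⟩ := List.mem_map.1 hy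
      exact (key i hi x (hl x hx)).1
    · intro z hz
      obtain ⟨x, hx, rfl⟩ := List.mem_map.1 hz
      exact mem_unionDom hi (hl x hx)

theorem isCopy (hC : Decomp C B k c r) (h : ∀ i < k, IsCopy (A i) (B i)) :
    IsCopy (union A k) C := by
  have : ∀ i, ∃ t, i < k → IsIsoFun (A i) (B i) t := fun i => by
    by_cases hi : i < k
    · obtain ⟨t, ht⟩ := isCopy_iff.1 (h i hi)
      exact ⟨t, fun _ => ht⟩
    · exact ⟨id, fun h => absurd h hi⟩
  choose t ht using this
  exact isCopy_iff.2 ⟨_, hC.isIsoFun_glue ht⟩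

/-- Restriction to components is computable in the whole isomorphism; conversely, finitely many
isomorphisms computable in one oracle are glued through their finite join. -/
theorem isoSpec_eq (hC : Decomp C B k c r) :
    IsoSpec (union A k) C = ⋂ i < k, IsoSpec (A i) (B i) := by
  ext e
  obtain ⟨g, rfl⟩ := exists_deg_eq e
  have hu : Computable fun z : ℕ => z.unpair.1 := Computable.fst.comp Computable.unpair
  simp only [Set.mem_iInter, deg_mem_isoSpec]
  constructor
  · rintro ⟨t, ht, hg⟩ i hi
    have hp : Computable fun x : ℕ => Nat.pair i x :=
      (Primrec₂.natPair.comp (Primrec.const i) Primrec.id).to_comp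
    exact ⟨_, hC.isIsoFun_component ht hi,
      (Red.of_computable hC.computable_retr g).comp (hg.comp (Red.of_computable hp g))⟩
  · intro h
    have : ∀ i, ∃ t, i < k → IsIsoFun (A i) (B i) t ∧ Red t g := fun i => by
      by_cases hi : i < k
      · obtain ⟨t, ht⟩ := h i hi
        exact ⟨t, fun _ => ht⟩
      · exact ⟨id, fun h => absurd h hi⟩
    choose t ht using this
    refine ⟨fun z => c z.unpair.1 (join t k z), ?_, Red.comp₂ hC.computable_incl
      (Red.of_computable hu g) (Red.join fun i hi => (ht i hi).2)⟩
    refine (hC.isIsoFun_glue fun i hi => (ht i hi).1).congr fun z hz => ?_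
    simp only [join, if_pos hz.1]

end Decomp

/-- Every copy of a disjoint union is a disjoint union of copies of the components. -/
theorem exists_decomp_of_isCopy {A : ℕ → CompStructure L} {k : ℕ}
    {C : CompStructure (unionLanguage L)} (hC : IsCopy (union A k) C) :
    ∃ B : ℕ → CompStructure L, Decomp C B k (fun _ y => y) id ∧ ∀ i < k, IsCopy (A i) (B i) := by
  obtain ⟨t, ht⟩ := isCopy_iff.1 hC
  have key : ∀ i m l, Diag C (Nat.pair 2 (Nat.pair i m)) l ↔
      i < k ∧ ∃ w, Diag (A i) m w ∧ l = w.map fun x => t (Nat.pair i x) := by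
    intro i m l
    constructor
    · intro h
      obtain ⟨l', hl', rfl⟩ := ht.exists_lift h.mem
      obtain ⟨hi, w, rfl, hw⟩ := diag_union.1 ((ht.diag_iff _ _ hl').2 h)
      exact ⟨hi, w, hw, List.map_map⟩
    · rintro ⟨hi, w, hw, rfl⟩
      have h1 := diag_union.2 ⟨hi, w, rfl, hw⟩
      have h2 := (ht.diag_iff _ _ h1.mem).1 h1
      rwa [List.map_map] at h2
  have hB : ∀ i, ∃ B : CompStructure L, i < k →
      IsIsoFun (A i) B (fun x => t (Nat.pair i x)) ∧
        ∀ m l, Diag B m l ↔ Diag C (Nat.pair 2 (Nat.pair i m)) l := by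
    intro i
    by_cases hi : i < k
    · have hcomp : Computable fun p : ℕ × List ℕ => (Nat.pair 2 (Nat.pair i p.1), p.2) :=
        (Primrec.pair (Primrec₂.natPair.comp (Primrec.const 2)
          (Primrec₂.natPair.comp (Primrec.const i) Primrec.fst)) Primrec.snd).to_comp
      -- The `i`-th component of `C` is decidable although `t` may not be computable: its diagram is
      -- the family of relations of `C` with first index `i`.
      obtain ⟨B, h1, h2⟩ := exists_image (A := A i) (t := fun x => t (Nat.pair i x))
        (P := fun m l => Diag C (Nat.pair 2 (Nat.pair i m)) l)
        (fun x hx y hy h => (Nat.pair_eq_pair.1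
          (ht.bijOn.injOn (mem_unionDom hi hx) (mem_unionDom hi hy) h)).2)
        (computablePred_comp (computablePred_diag C) hcomp)
        (fun m l => by simp [key, hi])
      exact ⟨B, fun _ => ⟨h1, h2⟩⟩
    · exact ⟨A i, fun h => absurd h hi⟩
  choose B hB using hB
  have hlift : ∀ i < k, ∀ y ∈ (B i).dom, ∃ x ∈ (A i).dom, t (Nat.pair i x) = y :=
    fun i hi y hy => (hB i hi).1.bijOn.surjOn hy
  refine ⟨B, ⟨Computable.snd, Computable.id, ?_, fun _ _ _ _ => rfl, ?_, ?_, ?_⟩,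
    fun i hi => isCopy_iff.2 ⟨_, (hB i hi).1⟩⟩
  · intro i hi y hy
    obtain ⟨x, hx, rfl⟩ := hlift i hi y hy
    exact ht.bijOn.mapsTo (mem_unionDom hi hx)
  · intro z hz
    obtain ⟨u, hu, rfl⟩ := ht.bijOn.surjOn hz
    refine ⟨_, hu.1, _, (hB _ hu.1).1.bijOn.mapsTo hu.2, ?_⟩
    simp
  · intro i hi i' hi' y hy y' hy' h
    obtain ⟨x, hx, rfl⟩ := hlift i hi y hy
    obtain ⟨x', hx', rfl⟩ := hlift i' hi' y' hy'
    exact (Nat.pair_eq_pair.1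
      (ht.bijOn.injOn (mem_unionDom hi hx) (mem_unionDom hi' hx') h)).1
  · intro i m l
    constructor
    · intro h
      have hi := ((key i m l).1 h).1
      exact ⟨hi, l, (List.map_id _).symm, ((hB i hi).2 m l).2 h⟩
    · rintro ⟨hi, w, rfl, hw⟩
      rw [List.map_id']
      exact ((hB i hi).2 m w).1 hw

/-! ### Categoricity spectra and spectral dimension of disjoint unions -/

/-- A copy `B` of `M` is tested by the union of `k` copies of `B`; conversely every copy of the
union splits into `k` copies of `M`. -/
theorem catSpec_union (M : CompStructure L) {k : ℕ} (hk : 0 < k) :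
    CatSpec (union (fun _ => M) k) = CatSpec M := by
  ext e
  constructor
  · intro he B hB
    have hU := decomp_union (fun _ => B) k
    have := he _ (hU.isCopy fun _ _ => hB)
    rw [hU.isoSpec_eq] at this
    exact Set.mem_iInter₂.1 this 0 hk
  · intro he C hC
    obtain ⟨B, hB, hcopy⟩ := exists_decomp_of_isCopy hC
    rw [hB.isoSpec_eq]
    exact Set.mem_iInter₂.2 fun i hi => he (B i) (hcopy i hi)

theorem specDim_eq_one {M A B : CompStructure L} (hA : IsCopy M A) (hB : IsCopy M B)
    (h : CatSpec M = IsoSpec A B) : SpecDim M = 1 := by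
  refine le_antisymm (sInf_le ?_) (le_sInf ?_)
  · exact ⟨{(A, B)}, Set.singleton_nonempty _, by simp [hA, hB], by simp, by simp [h]⟩
  · rintro _ ⟨X, hX, -, rfl, -⟩
    exact Set.one_le_encard_iff_nonempty.2 hX

/-- The degree of categoricity of a structure of finite spectral dimension is a strong degree of
categoricity. -/
theorem exists_strong_of_finite {M : CompStructure L} {d : Degree}
    (hd : IsDegreeOfCategoricity d M) {X : Set (CompStructure L × CompStructure L)}
    (hfin : X.Finite) (hne : X.Nonempty) (hX : ∀ p ∈ X, IsCopy M p.1 ∧ IsCopy M p.2)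
    (hcat : CatSpec M = ⋂ p ∈ X, IsoSpec p.1 p.2) :
    ∃ N : CompStructure (unionLanguage L), IsStrongDegreeOfCategoricity d N := by
  obtain ⟨k, p, hp⟩ : ∃ (k : ℕ) (p : ℕ → CompStructure L × CompStructure L),
      X = p '' Set.Iio k := by
    have := hfin.to_subtype
    obtain ⟨k, ⟨e⟩⟩ := Finite.exists_equiv_fin X
    refine ⟨k, fun i => if h : i < k then (e.symm ⟨i, h⟩).1 else hne.some, ?_⟩
    ext q
    constructor
    · intro hq
      exact ⟨e ⟨q, hq⟩, (e ⟨q, hq⟩).2, by simp⟩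
    · rintro ⟨i, hi, rfl⟩
      simp only [dif_pos (Set.mem_Iio.1 hi)]
      exact Subtype.property _
  have hk : 0 < k := by
    rw [hp] at hne
    obtain ⟨_, i, hi, -⟩ := hne
    exact (Nat.zero_le i).trans_lt hi
  have hpX : ∀ i < k, p i ∈ X := fun i hi => hp ▸ ⟨i, hi, rfl⟩
  refine ⟨union (fun _ => M) k, ?_, ?_⟩
  · rw [IsDegreeOfCategoricity, catSpec_union M hk]
    exact hd
  · refine specDim_eq_one (A := union (fun i => (p i).1) k) (B := union (fun i => (p i).2) k)
      ((decomp_union _ k).isCopy fun i hi => (hX _ (hpX i hi)).1)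
      ((decomp_union _ k).isCopy fun i hi => (hX _ (hpX i hi)).2) ?_
    rw [catSpec_union M hk, hcat, (decomp_union _ k).isoSpec_eq, hp]
    simp

/-! ### Finitely generated sets of degrees -/

/-- If finitely generated sets of degrees intersect in the cone above `d`, then finitely many of
them do: otherwise, by compactness, choose a generator of each set so that no finite join of the
chosen generators computes `d`, and apply cone avoidance. -/
theorem exists_finite_iInter_subset_Ici {Z : ℕ → Set Degree} {d : Degree}
    (hZ : ∀ i, FinitelyGenerated (Z i)) (h : ⋂ i, Z i ⊆ Set.Ici d) :
    ∃ k, ⋂ i < k, Z i ⊆ Set.Ici d := by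
  by_contra! hcon
  simp only [Set.not_subset] at hcon
  choose e he hed using hcon
  obtain ⟨d, rfl⟩ := exists_deg_eq d
  have hgen : ∀ i, ∃ a : ℕ → ℕ, deg a ∈ Z i ∧ Set.Ici (deg a) ⊆ Z i ∧
      ∀ᶠ k in Filter.hyperfilter ℕ, deg a ≤ e k := by
    intro i
    obtain ⟨X, hfin, hsub, heq⟩ := hZ i
    have hev : ∀ᶠ k in (Filter.hyperfilter ℕ : Filter ℕ), ∃ a ∈ X, a ≤ e k := by
      have : ∀ᶠ k in (Filter.hyperfilter ℕ : Filter ℕ), i < k := by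
        refine Filter.hyperfilter_le_cofinite ?_
        rw [Nat.cofinite_eq_atTop]
        exact Filter.eventually_gt_atTop i
      filter_upwards [this] with k hk
      have hk' := Set.mem_iInter₂.1 (he k) i hk
      rw [heq] at hk'
      simpa using hk'
    -- An ultrafilter commutes with finite disjunctions: one fixed generator is below `e k` for
    -- almost all `k`.
    obtain ⟨a, ha, hae⟩ := (Ultrafilter.eventually_exists_mem_iff hfin).1 hev
    obtain ⟨a, rfl⟩ := exists_deg_eq a
    exact ⟨a, hsub ha, heq ▸ Set.subset_biUnion_of_mem (u := Set.Ici) ha, hae⟩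
  choose a _ haZ hae using hgen
  have hjoin : ∀ n, ¬ Red d (join a n) := by
    intro n hn
    -- Finitely many sets of the ultrafilter meet, so a single `e k` bounds the first `n` chosen
    -- generators and hence their join; but `e k` is not above `d`.
    have hev : ∀ᶠ k in (Filter.hyperfilter ℕ : Filter ℕ), ∀ i ∈ Set.Iio n, deg (a i) ≤ e k :=
      (Filter.eventually_all_finite (Set.finite_Iio n)).2 fun i _ => hae i
    obtain ⟨k, hk⟩ := hev.exists
    obtain ⟨g, hg⟩ := exists_deg_eq (e k)
    refine hed k ?_
    rw [Set.mem_Ici, ← hg, deg_le_deg]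
    refine hn.trans (Red.join fun i hi => deg_le_deg.1 ?_)
    rw [hg]
    exact hk i hi
  obtain ⟨g, hg, hdg⟩ := exists_upper_bound_not_red hjoin
  have hmem : deg g ∈ ⋂ i, Z i := Set.mem_iInter.2 fun i => haZ i (deg_le_deg.2 (hg i))
  exact hdg (deg_le_deg.1 (h hmem))

/-! ### Generators of isomorphism spectra, and the conclusion -/

theorem isoSpec_eq_iUnion (A B : CompStructure L) :
    IsoSpec A B = ⋃ f : Iso A B, Set.Ici (deg f.total) := by
  ext e
  simp [IsoSpec]

theorem finitelyGenerated_isoSpec {A B : CompStructure L} [Finite (Iso A B)] :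
    FinitelyGenerated (IsoSpec A B) := by
  refine ⟨Set.range fun f : Iso A B => deg f.total, Set.finite_range _, ?_, ?_⟩
  · rintro _ ⟨f, rfl⟩
    exact ⟨f, le_rfl⟩
  · rw [isoSpec_eq_iUnion, Set.biUnion_range]

/-- Composition with the inverse of one fixed isomorphism embeds the isomorphisms from `A` to `B`
into the automorphisms of `A`. -/
theorem finite_iso {A B : CompStructure L} [Finite (Iso A A)] (h : IsCopy A B) :
    Finite (Iso A B) := by
  obtain ⟨f⟩ := h
  refine Finite.of_injective (fun g : Iso A B => f.symm.comp g) fun g g' hg => ?_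
  refine FirstOrder.Language.Equiv.ext fun x => f.symm.injective ?_
  exact DFunLike.congr_fun hg x

/-- Otherwise the countably many spectra `IsoSpec M B` could be cut down to finitely many with the
same intersection, contradicting the infinite dimension. -/
theorem exists_not_finitelyGenerated {M : CompStructure L} {d : Degree}
    (hd : IsDegreeOfCategoricity d M) (hdim : SpecDim M = ⊤) :
    ∃ B : CompStructure L, IsCopy M B ∧ ¬ FinitelyGenerated (IsoSpec M B) := by
  by_contra! hfg
  have hM : IsCopy M M := ⟨FirstOrder.Language.Equiv.refl _ _⟩
  obtain ⟨B, hB⟩ := (Set.to_countable {B : CompStructure L | IsCopy M B}).exists_eq_range ⟨M, hM⟩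
  have hcopy : ∀ i, IsCopy M (B i) := fun i => by
    have : B i ∈ {B : CompStructure L | IsCopy M B} := hB ▸ ⟨i, rfl⟩
    exact this
  have hcat : CatSpec M = ⋂ i, IsoSpec M (B i) := by
    ext e
    rw [Set.mem_iInter]
    refine ⟨fun he i => he _ (hcopy i), fun he C hC => ?_⟩
    obtain ⟨i, rfl⟩ : C ∈ Set.range B := hB ▸ hC
    exact he i
  obtain ⟨k, hk⟩ := exists_finite_iInter_subset_Ici (fun i => hfg _ (hcopy i))
    (hcat.symm.trans hd).subset
  have hfin : (((fun i => (M, B i)) '' Set.Iio (k + 1)).encard) ≠ ⊤ :=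
    Set.encard_ne_top_iff.2 ((Set.finite_Iio _).image _)
  refine hfin (sInf_eq_top.1 hdim _ ?_)
  -- `k + 1` rather than `k`, because the set of pairs has to be nonempty even if `k = 0`.
  refine ⟨(fun i => (M, B i)) '' Set.Iio (k + 1), ⟨_, 0, Nat.succ_pos k, rfl⟩, ?_, rfl, ?_⟩
  · rintro _ ⟨i, -, rfl⟩
    exact ⟨hM, hcopy i⟩
  · refine subset_antisymm (fun e he => ?_) (fun e he => ?_)
    · simp only [Set.mem_iInter]
      rintro _ ⟨i, -, rfl⟩
      exact he _ (hcopy i)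
    · rw [hd]
      refine hk (Set.mem_iInter₂.2 fun i hi => ?_)
      exact Set.mem_iInter₂.1 he (M, B i) ⟨i, Nat.lt_succ_of_lt hi, rfl⟩

end CompStr

theorem theoremA (L : CompStr.CompLanguage) (M : CompStr.CompStructure L) (d : CompStr.Degree)
    (hd : CompStr.IsDegreeOfCategoricity d M)
    (hstrong : ∀ (L' : CompStr.CompLanguage) (N : CompStr.CompStructure L'),
      ¬ CompStr.IsStrongDegreeOfCategoricity d N) :
    CompStr.SpecDim M = ⊤ ∧
      Infinite (CompStr.Iso M M) ∧
      ∃ A B : CompStr.CompStructure L, CompStr.IsCopy M A ∧ CompStr.IsCopy M B ∧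
        ¬ CompStr.FinitelyGenerated (CompStr.IsoSpec A B) := by
  have hdim : CompStr.SpecDim M = ⊤ := by
    refine sInf_eq_top.2 ?_
    rintro _ ⟨X, hne, hX, rfl, hcat⟩
    by_contra hfin
    obtain ⟨N, hN⟩ :=
      CompStr.exists_strong_of_finite hd (Set.encard_ne_top_iff.1 hfin) hne hX hcat
    exact hstrong _ N hN
  obtain ⟨B, hB, hfg⟩ := CompStr.exists_not_finitelyGenerated hd hdim
  refine ⟨hdim, not_finite_iff_infinite.1 fun _ => hfg ?_, M, B,
    ⟨FirstOrder.Language.Equiv.refl _ _⟩, hB, hfg⟩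
  have := CompStr.finite_iso hB
  exact CompStr.finitelyGenerated_isoSpec
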